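/- Let $E: y^2+a_1xy+a_3y=x^3+a_2x^2+a_4x+a_6$ be an elliptic curve over $\mathbb{Q}$ given by a global minimal Weierstrass equation (with $a_i\in\mathbb{Z}$), with invariants $c_4,c_6,\Delta$, and let $d$ be a square-free integer. Let $E^d$ be the twisted equation $$y^2+a_1xy+a_3y=x^3+\Big(a_2d+a_1^2\tfrac{d-1}{4}\Big)x^2+\Big(a_4d^2+a_1a_3\tfrac{d^2-1}{2}\Big)x+\Big(a_6d^3+a_3^2\tfrac{d^3-1}{4}\Big).$$ A transformation $[u,r,s,t]$ from one Weierstrass equation (coordinates $x,y$) to another (coordinates $x',y'$) is $x=u^2x'+r$, $y=u^3y'+u^2sx'+t$. For a Weierstrass equation $F$ with coefficients $a_i(F)$ put $\omega(F)=dx/(2y+a_1(F)x+a_3(F))$. Write $v_p$ for the $p$-adic valuation ($v_p(0)=\infty$), call $(v_2(c_4),v_2(c_6),v_2(\Delta))$ the 2-adic signature of $E$, and define $\tilde u=\prod_p u_p$, where: 1. If $p$ is an odd prime dividing $d$: $u_p=1$ if $\min\{3v_p(c_4),2v_p(c_6),v_p(\Delta)\}<6$, or if $p=3$ and $v_3(c_6)=5$;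 otherwise $u_p=p$. If $p$ is an odd prime not dividing $d$: $u_p=1$. 2. If $p=2$: (a) if $d\equiv1\pmod 4$, then $u_2=1$; (b) if $d\equiv3\pmod 4$, then $u_2=1/2$ if the 2-adic signature is $(0,0,c)$ with $c\ge0$, or $(a,3,0)$ with $4\le a\le\infty$; $u_2=2$ if it is $(4,6,c)$ with $c\ge12$ and $2^{-6}c_6d\equiv-1\pmod 4$, or $(a,9,12)$ with $a\ge8$ and $2^{-9}c_6d\equiv1\pmod 4$; otherwise $u_2=1$; (c) if $d\equiv2\pmod 4$ and $w=d/2$, then $u_2=1/2$ if the 2-adic signature is $(0,0,c)$ with $c\ge0$; $u_2=4$ if it is $(6,9,c)$ with $c\ge18$ and $2^{-9}c_6w\equiv-1\pmod 4$; $u_2=1$ if $v_2(c_4)\in\{4,5\}$, or $v_2(c_6)\in\{3,5,7\}$, or the signature is $(a,6,6)$ with $a\ge6$ and $2^{-6}c_6w\equiv-1\pmod 4$; otherwise $u_2=2$. Let $K\supseteq\mathbb{Q}$ be a field containing a square root $\sqrt d$ of $d$, and put $\alpha=1/\sqrt d$. Over $K$, the transformation $x=\alpha^2x'$, $y=\alpha^3y'+\frac{a_1\alpha^2(\alpha-1)}2x'+\frac{a_3(\alpha^3-1)}2$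 takes $E$ to $E^d$. Identifying differentials on the two curves by pulling back along the corresponding isomorphism $E\to E^d$, one has $$\omega(E^d)=\frac{\omega(E)}{\sqrt d}.$$ Moreover, there are $r,s,t\in\mathbb{Q}$ such that the transformation $[\tilde u,r,s,t]$ takes $E^d$ to a global minimal Weierstrass equation; and for every such $r,s,t$, if $E^d_{\min}$ denotes the resulting minimal equation, pulling back along the composite $E\to E^d\to E^d_{\min}$ gives $$\omega(E^d_{\min})=\frac{\tilde u\cdot\omega(E)}{\sqrt d}.$$ -/

import Mathlib

open scoped Polynomial

noncomputable section

namespace WeierstrassCurve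

/-! ### Isomorphisms of Weierstrass curves on coordinate rings and function fields -/

section Coordinates

variable {R : Type*} [CommRing R]

/-- The coordinate function `x` in the affine coordinate ring. -/
def coordX (W : WeierstrassCurve R) : W.toAffine.CoordinateRing :=
  Affine.CoordinateRing.mk W.toAffine (Polynomial.C Polynomial.X)

/-- The coordinate function `y` in the affine coordinate ring. -/
def coordY (W : WeierstrassCurve R) : W.toAffine.CoordinateRing :=
  Affine.CoordinateRing.mk W.toAffine Polynomial.X

/-- The Weierstrass equation of `W`, with coefficients in an `R`-algebra `A`. -/
def EquationIn (W : WeierstrassCurve R) {A : Type*} [CommRing A] [Algebra R A] (x y : A) : Prop :=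
  y ^ 2 + algebraMap R A W.a₁ * x * y + algebraMap R A W.a₃ * y =
    x ^ 3 + algebraMap R A W.a₂ * x ^ 2 + algebraMap R A W.a₄ * x + algebraMap R A W.a₆

theorem equationIn_coord (W : WeierstrassCurve R) : W.EquationIn W.coordX W.coordY := by
  have h : Affine.CoordinateRing.mk W.toAffine W.toAffine.polynomial = 0 := AdjoinRoot.mk_self
  have hC : ∀ a : R, algebraMap R W.toAffine.CoordinateRing a =
      Affine.CoordinateRing.mk W.toAffine (Polynomial.C (Polynomial.C a)) := fun _ => rfl
  unfold EquationIn coordX coordY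
  simp only [Affine.polynomial, map_sub, map_add, map_mul, map_pow] at h
  simp only [hC]
  linear_combination h

/-- The `R`-algebra homomorphism out of the coordinate ring given by a solution of the equation. -/
def coordLift (W : WeierstrassCurve R) {A : Type*} [CommRing A] [Algebra R A] {x y : A}
    (h : W.EquationIn x y) : W.toAffine.CoordinateRing →ₐ[R] A where
  toRingHom := AdjoinRoot.lift (Polynomial.aeval x : R[X] →ₐ[R] A).toRingHom y (by
    simp only [EquationIn] at h
    simp [Affine.polynomial, Polynomial.eval₂_add, Polynomial.eval₂_mul, Polynomial.eval₂_pow]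
    linear_combination h)
  commutes' a := by
    have : algebraMap R W.toAffine.CoordinateRing a =
      AdjoinRoot.of W.toAffine.polynomial (Polynomial.C a) := rfl
    simp [this]

@[simp] theorem coordLift_coordX (W : WeierstrassCurve R) {A : Type*} [CommRing A] [Algebra R A]
    {x y : A} (h : W.EquationIn x y) : W.coordLift h W.coordX = x := by
  have : W.coordX = AdjoinRoot.of W.toAffine.polynomial Polynomial.X := rfl
  simp [coordLift, this]

@[simp] theorem coordLift_coordY (W : WeierstrassCurve R) {A : Type*} [CommRing A] [Algebra R A]
    {x y : A} (h : W.EquationIn x y) : W.coordLift h W.coordY = y := by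
  have : W.coordY = AdjoinRoot.root W.toAffine.polynomial := rfl
  simp [coordLift, this]

theorem coordHom_ext (W : WeierstrassCurve R) {A : Type*} [CommRing A] [Algebra R A]
    {f g : W.toAffine.CoordinateRing →ₐ[R] A} (hx : f W.coordX = g W.coordX)
    (hy : f W.coordY = g W.coordY) : f = g := by
  apply AlgHom.coe_ringHom_injective
  apply AdjoinRoot.ringHom_ext
  · apply Polynomial.ringHom_ext
    · intro a
      exact (f.commutes a).trans (g.commutes a).symm
    · exact hx
  · exact hy

end Coordinates

section Pullback

variable {F : Type*} [Field F]

/-- For a change of variables `x = u²x' + r`, `y = u³y' + u²sx' + t` transforming the equation `W`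
into `W'`, the coordinates `x'`, `y'` as functions on `W` satisfy the equation of `W'`. -/
theorem equationIn_new (W W' : WeierstrassCurve F) (C : VariableChange F) (h : C • W = W') :
    W'.EquationIn
      (algebraMap F W.toAffine.CoordinateRing ((C.u⁻¹ : Fˣ) ^ 2) *
        (W.coordX - algebraMap F _ C.r))
      (algebraMap F W.toAffine.CoordinateRing ((C.u⁻¹ : Fˣ) ^ 3) *
        (W.coordY - algebraMap F _ C.s * (W.coordX - algebraMap F _ C.r) -
          algebraMap F _ C.t)) := by
  have e := W.equationIn_coord
  subst h
  simp only [EquationIn, variableChange_def, map_mul, map_add, map_sub, map_pow, map_ofNat] at e ⊢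
  linear_combination (algebraMap F W.toAffine.CoordinateRing ((C.u⁻¹ : Fˣ))) ^ 6 * e

theorem equationIn_old (W W' : WeierstrassCurve F) (C : VariableChange F) (h : C • W = W') :
    W.EquationIn
      (algebraMap F W'.toAffine.CoordinateRing ((C.u : F) ^ 2) * W'.coordX + algebraMap F _ C.r)
      (algebraMap F W'.toAffine.CoordinateRing ((C.u : F) ^ 3) * W'.coordY +
        algebraMap F _ ((C.u : F) ^ 2 * C.s) * W'.coordX + algebraMap F _ C.t) := by
  have e := W'.equationIn_coord
  have h' : W = C⁻¹ • W' := by rw [← h, inv_smul_smul]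
  have hu : (C.u : F) * (C.u⁻¹ : Fˣ) = 1 := by simp
  have hU : algebraMap F W'.toAffine.CoordinateRing C.u *
      algebraMap F W'.toAffine.CoordinateRing (C.u⁻¹ : Fˣ) = 1 := by
    rw [← map_mul, hu, map_one]
  obtain ⟨b₁, b₂, b₃, b₄, b₆⟩ : W'.a₁ * C.u = W.a₁ + 2 * C.s ∧
      W'.a₂ * C.u ^ 2 = W.a₂ - C.s * W.a₁ + 3 * C.r - C.s ^ 2 ∧
      W'.a₃ * C.u ^ 3 = W.a₃ + C.r * W.a₁ + 2 * C.t ∧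
      W'.a₄ * C.u ^ 4 = W.a₄ - C.s * W.a₃ + 2 * C.r * W.a₂ - (C.t + C.r * C.s) * W.a₁ +
        3 * C.r ^ 2 - 2 * C.s * C.t ∧
      W'.a₆ * C.u ^ 6 = W.a₆ + C.r * W.a₄ + C.r ^ 2 * W.a₂ + C.r ^ 3 - C.t * W.a₃ - C.t ^ 2 -
        C.r * C.t * W.a₁ := by
    subst h
    have hu0 : (C.u : F) ≠ 0 := C.u.ne_zero
    simp only [variableChange_def, Units.val_inv_eq_inv_val]
    refine ⟨?_, ?_, ?_, ?_, ?_⟩ <;> field_simp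
  apply_fun algebraMap F W'.toAffine.CoordinateRing at b₁ b₂ b₃ b₄ b₆
  simp only [EquationIn, map_mul, map_add, map_sub, map_pow, map_ofNat] at e b₁ b₂ b₃ b₄ b₆ ⊢
  set x := W'.coordX
  set y := W'.coordY
  set u := algebraMap F W'.toAffine.CoordinateRing C.u
  linear_combination u ^ 6 * e - u ^ 5 * x * y * b₁ + u ^ 4 * x ^ 2 * b₂ - u ^ 3 * y * b₃ +
    u ^ 2 * x * b₄ + b₆

/-- The isomorphism of affine coordinate rings `F[W'] ≃ F[W]` (composition of functions on `W'`
with the isomorphism of curves `W → W'`) given by a change of variables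
`x = u²x' + r`, `y = u³y' + u²sx' + t` transforming the equation `W` into `W'`. It sends `x'` to
`u⁻²(x - r)` and `y'` to `u⁻³(y - s(x - r) - t)`. -/
def coordEquiv (W W' : WeierstrassCurve F) (C : VariableChange F) (h : C • W = W') :
    W'.toAffine.CoordinateRing ≃ₐ[F] W.toAffine.CoordinateRing :=
  AlgEquiv.ofAlgHom (W'.coordLift (equationIn_new W W' C h)) (W.coordLift (equationIn_old W W' C h))
    (by
      have hU : algebraMap F W.toAffine.CoordinateRing C.u *
          algebraMap F W.toAffine.CoordinateRing (C.u⁻¹ : Fˣ) = 1 := by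
        rw [← map_mul, Units.mul_inv, map_one]
      set u := algebraMap F W.toAffine.CoordinateRing C.u
      set v := algebraMap F W.toAffine.CoordinateRing (C.u⁻¹ : Fˣ)
      have hU2 : u ^ 2 * v ^ 2 = 1 := by rw [← mul_pow, hU, one_pow]
      have hU3 : u ^ 3 * v ^ 3 = 1 := by rw [← mul_pow, hU, one_pow]
      apply coordHom_ext
      · simp only [AlgHom.comp_apply, coordLift_coordX, map_add, map_mul, AlgHom.commutes,
          AlgHom.id_apply, map_pow]
        linear_combination (W.coordX - algebraMap F _ C.r) * hU2
      · simp only [AlgHom.comp_apply, coordLift_coordX, coordLift_coordY, map_add, map_mul,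
          AlgHom.commutes, AlgHom.id_apply, map_pow]
        linear_combination (W.coordY - algebraMap F _ C.s * (W.coordX - algebraMap F _ C.r) -
          algebraMap F _ C.t) * hU3 + algebraMap F _ C.s * (W.coordX - algebraMap F _ C.r) * hU2)
    (by
      have hU : algebraMap F W'.toAffine.CoordinateRing C.u *
          algebraMap F W'.toAffine.CoordinateRing (C.u⁻¹ : Fˣ) = 1 := by
        rw [← map_mul, Units.mul_inv, map_one]
      set u := algebraMap F W'.toAffine.CoordinateRing C.u
      set v := algebraMap F W'.toAffine.CoordinateRing (C.u⁻¹ : Fˣ)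
      have hU2 : u ^ 2 * v ^ 2 = 1 := by rw [← mul_pow, hU, one_pow]
      have hU3 : u ^ 3 * v ^ 3 = 1 := by rw [← mul_pow, hU, one_pow]
      apply coordHom_ext
      · simp only [AlgHom.comp_apply, coordLift_coordX, map_sub, map_mul,
          AlgHom.commutes, AlgHom.id_apply, map_pow]
        linear_combination W'.coordX * hU2
      · simp only [AlgHom.comp_apply, coordLift_coordX, coordLift_coordY, map_sub,
          map_mul, AlgHom.commutes, AlgHom.id_apply, map_pow]
        linear_combination W'.coordY * hU3)

/-- The induced isomorphism of function fields `F(W') ≃ F(W)`. -/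
def functionFieldEquiv (W W' : WeierstrassCurve F) (C : VariableChange F) (h : C • W = W') :
    W'.toAffine.FunctionField ≃ₐ[F] W.toAffine.FunctionField :=
  IsFractionRing.fieldEquivOfAlgEquiv F W'.toAffine.FunctionField W.toAffine.FunctionField
    (coordEquiv W W' C h)

/-- The map on Kähler differentials induced by a homomorphism of `F`-algebras. -/
def kaehlerMap {A B : Type*} [CommRing A] [CommRing B] [Algebra F A] [Algebra F B]
    (φ : A →ₐ[F] B) : KaehlerDifferential F A →ₗ[F] KaehlerDifferential F B :=
  letI : Algebra A B := φ.toRingHom.toAlgebra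
  haveI : IsScalarTower F A B := IsScalarTower.of_algebraMap_eq fun a => (φ.commutes a).symm
  (KaehlerDifferential.map F F A B).restrictScalars F

/-- The pullback of differentials from `W'` to `W` along the isomorphism of curves `W → W'` given
by a change of variables transforming the equation `W` into `W'`. -/
def pullback (W W' : WeierstrassCurve F) (C : VariableChange F) (h : C • W = W') :
    KaehlerDifferential F W'.toAffine.FunctionField →ₗ[F]
      KaehlerDifferential F W.toAffine.FunctionField :=
  kaehlerMap (functionFieldEquiv W W' C h : W'.toAffine.FunctionField →ₐ[F] _)

/-- The invariant differential `dx / (2y + a₁x + a₃)`, as a Kähler differential of the function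
field. -/
def invariantDifferential (W : WeierstrassCurve F) :
    KaehlerDifferential F W.toAffine.FunctionField :=
  (algebraMap W.toAffine.CoordinateRing W.toAffine.FunctionField
      (2 * W.coordY + algebraMap F _ W.a₁ * W.coordX + algebraMap F _ W.a₃))⁻¹ •
    KaehlerDifferential.D F W.toAffine.FunctionField
      (algebraMap W.toAffine.CoordinateRing W.toAffine.FunctionField W.coordX)

end Pullback

/-! ### Global minimality over `ℚ` -/

/-- All coefficients of `W` are `p`-integral. -/
def IsIntegralAt (p : ℕ) (W : WeierstrassCurve ℚ) : Prop :=
  ¬ p ∣ W.a₁.den ∧ ¬ p ∣ W.a₂.den ∧ ¬ p ∣ W.a₃.den ∧ ¬ p ∣ W.a₄.den ∧ ¬ p ∣ W.a₆.den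

/-- A global minimal Weierstrass equation over `ℚ` of an elliptic curve: the coefficients are
integers, and for every prime `p` the `p`-adic valuation of the discriminant cannot be decreased by
a change of variables over `ℚ` leading to an equation with `p`-integral coefficients. -/
structure IsGlobalMinimal (W : WeierstrassCurve ℚ) : Prop where
  isElliptic : W.IsElliptic
  isIntegral : W.IsIntegral ℤ
  minimal : ∀ p : ℕ, p.Prime → ∀ C : VariableChange ℚ, (C • W).IsIntegralAt p →
    padicValRat p W.Δ ≤ padicValRat p (C • W).Δ

/-! ### Quadratic twists -/

/-- The twisted equation
`y² + a₁xy + a₃y = x³ + (a₂d + a₁²(d-1)/4)x² + (a₄d² + a₁a₃(d²-1)/2)x + (a₆d³ + a₃²(d³-1)/4)`. -/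
def quadraticTwist (W : WeierstrassCurve ℚ) (d : ℤ) : WeierstrassCurve ℚ where
  a₁ := W.a₁
  a₂ := W.a₂ * d + W.a₁ ^ 2 * ((d - 1) / 4)
  a₃ := W.a₃
  a₄ := W.a₄ * d ^ 2 + W.a₁ * W.a₃ * ((d ^ 2 - 1) / 2)
  a₆ := W.a₆ * d ^ 3 + W.a₃ ^ 2 * ((d ^ 3 - 1) / 4)

/-- With `α = 1/δ`, `δ² = d`, the transformation `x = α²x'`,
`y = α³y' + (a₁α²(α - 1)/2)x' + a₃(α³ - 1)/2` from `W` to its twist by `d`. -/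
def twistChange (W : WeierstrassCurve ℚ) {K : Type*} [Field K] [Algebra ℚ K] (δ : Kˣ) :
    VariableChange K where
  u := δ⁻¹
  r := 0
  s := algebraMap ℚ K W.a₁ * ((δ : K)⁻¹ - 1) / 2
  t := algebraMap ℚ K W.a₃ * ((δ : K)⁻¹ ^ 3 - 1) / 2

theorem twistChange_smul (W : WeierstrassCurve ℚ) {K : Type*} [Field K] [Algebra ℚ K] (d : ℤ)
    (δ : Kˣ) (hδ : (δ : K) ^ 2 = d) :
    W.twistChange δ • W.baseChange K = (W.quadraticTwist d).baseChange K := by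
  have : CharZero K := algebraRat.charZero K
  have h0 : (δ : K) ≠ 0 := δ.ne_zero
  ext <;> simp only [variableChange_def, twistChange, quadraticTwist, baseChange, map_a₁, map_a₂,
    map_a₃, map_a₄, map_a₆, inv_inv, map_add, map_mul, map_div₀, map_sub, map_pow, map_intCast,
    map_one, map_ofNat, ← hδ] <;> field_simp <;> ring

/-! ### The scaling factor of the minimal model of a twist -/

section Factor

/-- The `p`-adic valuation of an integer, equal to `∞` at `0`. -/
def pval (p : ℕ) (n : ℤ) : ℕ∞ := emultiplicity (p : ℤ) n

open Classical in
/-- The local factor `u_p` at an odd prime `p`. -/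
def oddFactor (E : WeierstrassCurve ℤ) (d : ℤ) (p : ℕ) : ℚ :=
  if (p : ℤ) ∣ d then
    if min (3 * pval p E.c₄) (min (2 * pval p E.c₆) (pval p E.Δ)) < 6 ∨
        (p = 3 ∧ pval p E.c₆ = 5) then 1
    else p
  else 1

open Classical in
/-- The local factor `u_2`. -/
def evenFactor (E : WeierstrassCurve ℤ) (d : ℤ) : ℚ :=
  if d ≡ 1 [ZMOD 4] then 1
  else if d ≡ 3 [ZMOD 4] then
    if (pval 2 E.c₄ = 0 ∧ pval 2 E.c₆ = 0) ∨
        (4 ≤ pval 2 E.c₄ ∧ pval 2 E.c₆ = 3 ∧ pval 2 E.Δ = 0) then 1 / 2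
    else if (pval 2 E.c₄ = 4 ∧ pval 2 E.c₆ = 6 ∧ 12 ≤ pval 2 E.Δ ∧
          E.c₆ / 2 ^ 6 * d ≡ -1 [ZMOD 4]) ∨
        (8 ≤ pval 2 E.c₄ ∧ pval 2 E.c₆ = 9 ∧ pval 2 E.Δ = 12 ∧
          E.c₆ / 2 ^ 9 * d ≡ 1 [ZMOD 4]) then 2
    else 1
  else
    -- here `d ≡ 2 mod 4`, since `d` is square-free
    if pval 2 E.c₄ = 0 ∧ pval 2 E.c₆ = 0 then 1 / 2
    else if pval 2 E.c₄ = 6 ∧ pval 2 E.c₆ = 9 ∧ 18 ≤ pval 2 E.Δ ∧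
        E.c₆ / 2 ^ 9 * (d / 2) ≡ -1 [ZMOD 4] then 4
    else if (pval 2 E.c₄ = 4 ∨ pval 2 E.c₄ = 5) ∨
        (pval 2 E.c₆ = 3 ∨ pval 2 E.c₆ = 5 ∨ pval 2 E.c₆ = 7) ∨
        (6 ≤ pval 2 E.c₄ ∧ pval 2 E.c₆ = 6 ∧ pval 2 E.Δ = 6 ∧
          E.c₆ / 2 ^ 6 * (d / 2) ≡ -1 [ZMOD 4]) then 1
    else 2

/-- The local factor `u_p` at a prime `p`. -/
def localFactor (E : WeierstrassCurve ℤ) (d : ℤ) (p : ℕ) : ℚ :=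
  if p = 2 then evenFactor E d else oddFactor E d p

theorem localFactor_ne_zero (E : WeierstrassCurve ℤ) (d : ℤ) {p : ℕ} (hp : p.Prime) :
    localFactor E d p ≠ 0 := by
  have := hp.ne_zero
  unfold localFactor evenFactor oddFactor
  split_ifs <;> first | exact_mod_cast this | norm_num

/-- The factor `ũ = ∏ u_p`. The product is over the primes dividing `2d`, since `u_p = 1` for
every other prime. -/
def twistFactor (E : WeierstrassCurve ℤ) (d : ℤ) : ℚˣ :=
  Units.mk0 (∏ p ∈ (2 * d).natAbs.primeFactors, localFactor E d p)
    (Finset.prod_ne_zero_iff.mpr fun _ hp =>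
      localFactor_ne_zero E d (Nat.prime_of_mem_primeFactors hp))

/-- The transformation `[ũ, r, s, t]` applied to the twisted equation. -/
def twistModel (E : WeierstrassCurve ℤ) (d : ℤ) (r s t : ℚ) : WeierstrassCurve ℚ :=
  (⟨twistFactor E d, r, s, t⟩ : VariableChange ℚ) • (E.baseChange ℚ).quadraticTwist d

theorem baseChange_twistModel (E : WeierstrassCurve ℤ) (d : ℤ) (r s t : ℚ) (K : Type*) [Field K]
    [Algebra ℚ K] : (⟨twistFactor E d, r, s, t⟩ : VariableChange ℚ).baseChange K •
      ((E.baseChange ℚ).quadraticTwist d).baseChange K = (E.twistModel d r s t).baseChange K :=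
  map_variableChange _ _ (algebraMap ℚ K)

end Factor

/-! ### Pullbacks between a curve, its twist, and the minimal models of the twist -/

section TwistPullback

variable (E : WeierstrassCurve ℤ) (d : ℤ) {K : Type*} [Field K] [Algebra ℚ K]

/-- Pullback of differentials from the twist to `E`, over a field containing `√d = δ`. -/
def twistPullback (δ : Kˣ) (hδ : (δ : K) ^ 2 = d) :
    KaehlerDifferential K
      (((E.baseChange ℚ).quadraticTwist d).baseChange K).toAffine.FunctionField →ₗ[K]
      KaehlerDifferential K ((E.baseChange ℚ).baseChange K).toAffine.FunctionField :=
  pullback _ _ ((E.baseChange ℚ).twistChange δ) (twistChange_smul _ d δ hδ)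

/-- Pullback of differentials from the model `[ũ, r, s, t]` of the twist to the twist. -/
def modelPullback (r s t : ℚ) :
    KaehlerDifferential K ((E.twistModel d r s t).baseChange K).toAffine.FunctionField →ₗ[K]
      KaehlerDifferential K
      (((E.baseChange ℚ).quadraticTwist d).baseChange K).toAffine.FunctionField :=
  pullback _ _ ((⟨twistFactor E d, r, s, t⟩ : VariableChange ℚ).baseChange K)
    (E.baseChange_twistModel d r s t K)

end TwistPullback

end WeierstrassCurve

end

/-!
A change of variables `[u, r, s, t]` multiplies the invariant differential by `u`, so both formulas
for differentials are immediate and the content is that `[ũ, r, s, t]` takes the twist to a global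
minimal equation for suitable `r, s, t`. The twist has invariants `(d² c₄, d³ c₆)`, and over `ℚ` an
equation is determined up to `[1, r, s, t]` by its invariants `(c₄, c₆)`. By Kraus, integers
`A, B` with `A³ - B² = 1728 D ≠ 0` are the invariants of an integral equation if and only if they
satisfy a congruence condition at `2` and one at `3`. Hence the claim is local: for each prime `p`,
`(d² c₄ / u_p⁴, d³ c₆ / u_p⁶)` satisfies the condition at `p`, whereas dividing once more by
`(p⁴, p⁶)` violates it or leaves the `p`-integers. At `2` the condition is invariant under twisting
by integers congruent to `1` modulo `4`, so that only `d = -1` and `d = ±2` need a computation.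
-/

namespace QuadraticTwist

open WeierstrassCurve

section Differentials

variable {F : Type*} [Field F]

theorem kaehlerMap_D {A B : Type*} [CommRing A] [CommRing B] [Algebra F A] [Algebra F B]
    (φ : A →ₐ[F] B) (a : A) :
    kaehlerMap φ (KaehlerDifferential.D F A a) = KaehlerDifferential.D F B (φ a) := by
  let : Algebra A B := φ.toRingHom.toAlgebra
  have : IsScalarTower F A B := IsScalarTower.of_algebraMap_eq fun a => (φ.commutes a).symm
  exact KaehlerDifferential.map_D F F A B a

theorem kaehlerMap_smul {A B : Type*} [CommRing A] [CommRing B] [Algebra F A] [Algebra F B]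
    (φ : A →ₐ[F] B) (a : A) (x : KaehlerDifferential F A) :
    kaehlerMap φ (a • x) = φ a • kaehlerMap φ x := by
  let : Algebra A B := φ.toRingHom.toAlgebra
  have : IsScalarTower F A B := IsScalarTower.of_algebraMap_eq fun a => (φ.commutes a).symm
  exact ((KaehlerDifferential.map F F A B).map_smul a x).trans (algebraMap_smul B a _).symm

variable {W W' : WeierstrassCurve F} {C : VariableChange F} (h : C • W = W')

theorem functionFieldEquiv_algebraMap (a : W'.toAffine.CoordinateRing) :
    functionFieldEquiv W W' C h (algebraMap _ _ a) = algebraMap _ _ (coordEquiv W W' C h a) := by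
  simp [functionFieldEquiv]

theorem coordEquiv_coordX :
    coordEquiv W W' C h W'.coordX = algebraMap F W.toAffine.CoordinateRing ((C.u⁻¹ : Fˣ) ^ 2) *
      (W.coordX - algebraMap F _ C.r) :=
  coordLift_coordX W' (equationIn_new W W' C h)

theorem coordEquiv_coordY :
    coordEquiv W W' C h W'.coordY = algebraMap F W.toAffine.CoordinateRing ((C.u⁻¹ : Fˣ) ^ 3) *
      (W.coordY - algebraMap F _ C.s * (W.coordX - algebraMap F _ C.r) - algebraMap F _ C.t) :=
  coordLift_coordY W' (equationIn_new W W' C h)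

theorem coordEquiv_two_mul_coordY_add :
    coordEquiv W W' C h
        (2 * W'.coordY + algebraMap F _ W'.a₁ * W'.coordX + algebraMap F _ W'.a₃) =
      algebraMap F W.toAffine.CoordinateRing ((C.u⁻¹ : Fˣ) ^ 3) *
        (2 * W.coordY + algebraMap F _ W.a₁ * W.coordX + algebraMap F _ W.a₃) := by
  simp only [map_add, map_mul, AlgEquiv.commutes, coordEquiv_coordX, coordEquiv_coordY, map_ofNat]
  subst h
  simp only [variableChange_def, map_mul, map_add, map_pow, map_ofNat]
  ring

theorem D_coordEquiv_coordX :
    KaehlerDifferential.D F W.toAffine.FunctionField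
        (algebraMap _ _ (coordEquiv W W' C h W'.coordX)) =
      ((C.u⁻¹ : Fˣ) ^ 2 : F) •
        KaehlerDifferential.D F W.toAffine.FunctionField (algebraMap _ _ W.coordX) := by
  rw [coordEquiv_coordX, map_mul, map_sub, ← IsScalarTower.algebraMap_apply,
    ← IsScalarTower.algebraMap_apply, ← Algebra.smul_def, Derivation.map_smul, map_sub,
    Derivation.map_algebraMap, sub_zero]

theorem pullback_invariantDifferential :
    pullback W W' C h W'.invariantDifferential = (C.u : F) • W.invariantDifferential := by
  have hu : (((C.u⁻¹ : Fˣ) : F) ^ 3)⁻¹ * (C.u⁻¹ : Fˣ) ^ 2 = C.u := by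
    have := C.u.ne_zero
    rw [Units.val_inv_eq_inv_val]
    field_simp
  simp only [pullback, invariantDifferential, kaehlerMap_smul, kaehlerMap_D,
    AlgEquiv.coe_toAlgHom, map_inv₀, functionFieldEquiv_algebraMap, coordEquiv_two_mul_coordY_add,
    D_coordEquiv_coordX]
  rw [map_mul, ← IsScalarTower.algebraMap_apply, mul_inv, ← map_inv₀, mul_smul, algebraMap_smul,
    smul_comm _ ((C.u⁻¹ : Fˣ) ^ 2 : F), smul_smul, hu]

variable {E : WeierstrassCurve ℤ} {d : ℤ} {K : Type*} [Field K] [Algebra ℚ K]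

theorem twistPullback_invariantDifferential (δ : Kˣ) (hδ : (δ : K) ^ 2 = d) :
    twistPullback E d δ hδ
        (((E.baseChange ℚ).quadraticTwist d).baseChange K).invariantDifferential =
      (1 / (δ : K)) • ((E.baseChange ℚ).baseChange K).invariantDifferential := by
  rw [twistPullback, pullback_invariantDifferential, twistChange, Units.val_inv_eq_inv_val, one_div]

theorem modelPullback_invariantDifferential (r s t : ℚ) :
    modelPullback E d r s t ((E.twistModel d r s t).baseChange K).invariantDifferential =
      algebraMap ℚ K (E.twistFactor d) •
        (((E.baseChange ℚ).quadraticTwist d).baseChange K).invariantDifferential :=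
  pullback_invariantDifferential _

end Differentials

section Kraus

/-- Kraus's condition at `2` for `(A, B)` to be the invariants `(c₄, c₆)` of a `2`-integral
Weierstrass equation. -/
def KrausTwo (A B : ℤ) : Prop :=
  64 ∣ A ^ 3 - B ^ 2 ∧ (4 ∣ B + 1 ∨ 16 ∣ A ∧ (32 ∣ B ∨ 32 ∣ B - 8))

/-- Kraus's condition at `3` for `(A, B)` to be the invariants `(c₄, c₆)` of a `3`-integral
Weierstrass equation. -/
def KrausThree (A B : ℤ) : Prop :=
  27 ∣ A ^ 3 - B ^ 2 ∧ (9 ∣ B → 27 ∣ B)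

/-- Kraus's condition at `p` for `(A, B)` to be the invariants `(c₄, c₆)` of a `p`-integral
Weierstrass equation; it is empty unless `p` is `2` or `3`. -/
def Kraus (p : ℕ) (A B : ℤ) : Prop :=
  (p = 2 → KrausTwo A B) ∧ (p = 3 → KrausThree A B)

theorem krausTwo_invariants (W : WeierstrassCurve ℤ) : KrausTwo W.c₄ W.c₆ := by
  refine ⟨⟨27 * W.Δ, by linear_combination -W.c_relation⟩, ?_⟩
  obtain ⟨a₁, a₂, a₃, a₄, a₆⟩ := W
  simp only [c₆, c₄, b₂, b₄, b₆]
  rcases Int.even_or_odd' a₁ with ⟨k, rfl | rfl⟩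
  · refine Or.inr ⟨⟨(k ^ 2 + a₂) ^ 2 - 3 * (a₄ + k * a₃), by ring⟩, ?_⟩
    rcases Int.even_or_odd' a₃ with ⟨l, rfl | rfl⟩
    · exact Or.inl ⟨-2 * (k ^ 2 + a₂) ^ 3 + 9 * (k ^ 2 + a₂) * (a₄ + 2 * k * l) -
        27 * (l ^ 2 + a₆), by ring⟩
    · exact Or.inr ⟨-2 * (k ^ 2 + a₂) ^ 3 + 9 * (k ^ 2 + a₂) * (a₄ + k * (2 * l + 1)) -
        27 * (l ^ 2 + l + a₆) - 7, by ring⟩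
  · set m := k ^ 2 + k + a₂
    have hb₂ : (2 * k + 1) ^ 2 + 4 * a₂ = 4 * m + 1 := by simp only [m]; ring
    rw [hb₂]
    exact Or.inl ⟨-(16 * m ^ 3 + 12 * m ^ 2 + 3 * m) +
      9 * (4 * m + 1) * (2 * a₄ + (2 * k + 1) * a₃) - 54 * (a₃ ^ 2 + 4 * a₆), by ring⟩

theorem krausThree_invariants (W : WeierstrassCurve ℤ) : KrausThree W.c₄ W.c₆ := by
  refine ⟨⟨64 * W.Δ, by linear_combination -W.c_relation⟩, fun ⟨k, hk⟩ => ?_⟩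
  simp only [c₆] at hk ⊢
  have hb₂_pow : (3 : ℤ) ∣ W.b₂ ^ 3 :=
    ⟨-3 * k + 12 * W.b₂ * W.b₄ - 72 * W.b₆, by linear_combination -hk⟩
  obtain ⟨l, hl⟩ := Int.prime_three.dvd_of_dvd_pow hb₂_pow
  exact ⟨-l ^ 3 + 4 * l * W.b₄ - 8 * W.b₆, by rw [hl]; ring⟩

theorem kraus_invariants (p : ℕ) (W : WeierstrassCurve ℤ) : Kraus p W.c₄ W.c₆ :=
  ⟨fun _ => krausTwo_invariants W, fun _ => krausThree_invariants W⟩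

theorem c₄_eq_and_c₆_eq_of_b₂_eq_neg {W : WeierstrassCurve ℤ} {A B : ℤ} (h₂ : W.b₂ = -B)
    (h₄ : 24 * W.b₄ = B ^ 2 - A) (h₆ : 432 * W.b₆ = B * (3 * A - B ^ 2 - 2)) :
    W.c₄ = A ∧ W.c₆ = B := by
  constructor
  · rw [c₄, h₂]
    linear_combination -h₄
  · refine mul_left_cancel₀ (two_ne_zero (α := ℤ)) ?_
    rw [c₆, h₂]
    linear_combination -3 * B * h₄ - h₆

theorem mul_eq_sub_sq_mul (A B : ℤ) :
    B * (3 * A - B ^ 2 - 2) = B * ((A ^ 3 - B ^ 2) - (A - 1) ^ 2 * (A + 2)) := by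
  ring

theorem KrausThree.dvd {A B : ℤ} (h : KrausThree A B) :
    3 ∣ B ^ 2 - A ∧ 27 ∣ B * (3 * A - B ^ 2 - 2) := by
  obtain ⟨hAB, hB⟩ := h
  have hA : (3 : ℤ) ∣ B ^ 2 - A := by
    have hA_cube : (3 : ℤ) ∣ A ^ 3 - A :=
      (ZMod.intCast_zmod_eq_zero_iff_dvd _ 3).1 (by simp [ZMod.pow_card (A : ZMod 3)])
    omega
  refine ⟨hA, ?_⟩
  by_cases h3 : (3 : ℤ) ∣ B
  · have hA3 : (3 : ℤ) ∣ A := by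
      have := h3.mul_left B
      rw [← sq] at this
      omega
    have hB_sq : (3 ^ 3 : ℤ) ∣ B ^ 2 := by
      have := pow_dvd_pow_of_dvd hA3 3
      omega
    have h9 : (9 : ℤ) ∣ B := by
      obtain ⟨b, rfl⟩ := h3
      have : (3 : ℤ) ∣ b ^ 2 := by rw [mul_pow] at hB_sq; omega
      have := Int.prime_three.dvd_of_dvd_pow this
      omega
    exact (hB h9).mul_right _
  · have hA1 : (3 : ℤ) ∣ A - 1 := by
      have : (3 : ℤ) ∣ B ^ 2 - 1 := by
        rw [show B ^ 2 - 1 = (B - 1) * (B + 1) by ring, Int.prime_three.dvd_mul]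
        omega
      omega
    obtain ⟨a, ha⟩ := hA1
    obtain rfl : A = 3 * a + 1 := by omega
    rw [mul_eq_sub_sq_mul]
    exact (hAB.sub ⟨a ^ 2 * (a + 1), by ring⟩).mul_left B

theorem KrausTwo.exists_dvd {A B : ℤ} (h : KrausTwo A B) :
    ∃ a₁ a₃ : ℤ, a₁ * a₃ = 0 ∧ 4 ∣ -B - a₁ ^ 2 ∧ 16 ∣ B ^ 2 - A ∧
      64 ∣ B * (3 * A - B ^ 2 - 2) - 432 * a₃ ^ 2 := by
  obtain ⟨hAB, hB | ⟨⟨a, rfl⟩, hB⟩⟩ := h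
  · have hB_sq : 8 ∣ B ^ 2 - 1 := Int.eight_dvd_sq_sub_one_of_odd (Int.odd_iff.2 (by omega))
    have hA_odd : Odd A := by
      have : Odd (A ^ 3) := Int.odd_iff.2 (by omega)
      exact (Int.odd_pow.1 this).resolve_right (by norm_num)
    have hA_sq : 8 ∣ A ^ 2 - 1 := Int.eight_dvd_sq_sub_one_of_odd hA_odd
    have hA_cube : A ^ 3 - A = A * (A ^ 2 - 1) := by ring
    have hA1 : 8 ∣ A - 1 := by
      have := hA_sq.mul_left A
      omega
    obtain ⟨k, hk⟩ := hA1
    obtain rfl : A = 8 * k + 1 := by omega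
    refine ⟨1, 0, by simp, by omega, ?_, ?_⟩
    · have : (16 : ℤ) ∣ (8 * k + 1) ^ 3 - (8 * k + 1) :=
        ⟨k * (8 * k + 1) * (4 * k + 1), by ring⟩
      omega
    · rw [mul_eq_sub_sq_mul]
      simpa using (hAB.sub ⟨k ^ 2 * (8 * k + 3), by ring⟩).mul_left B
  · obtain ⟨b, rfl⟩ : (8 : ℤ) ∣ B := by omega
    have h16 : (16 : ℤ) ∣ (8 * b) ^ 2 - 16 * a := ⟨4 * b ^ 2 - a, by ring⟩
    have h64 : 8 * b * (3 * (16 * a) - (8 * b) ^ 2 - 2) =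
        64 * (b * (6 * a - 8 * b ^ 2)) - 16 * b := by ring
    rw [h64]
    rcases hB with hB | hB
    · exact ⟨0, 0, by simp, by omega, h16, by omega⟩
    · exact ⟨0, 1, by simp, by omega, h16, by omega⟩

theorem exists_of_krausTwo_of_krausThree {A B : ℤ} (h₂ : KrausTwo A B) (h₃ : KrausThree A B) :
    ∃ W : WeierstrassCurve ℤ, W.c₄ = A ∧ W.c₆ = B := by
  obtain ⟨a₁, a₃, h₁₃, ⟨a₂, ha₂⟩, h16, h64⟩ := h₂.exists_dvd
  obtain ⟨h3, h27⟩ := h₃.dvd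
  obtain ⟨a₄, ha₄⟩ : 48 ∣ B ^ 2 - A := by omega
  obtain ⟨a₆, ha₆⟩ : 1728 ∣ B * (3 * A - B ^ 2 - 2) - 432 * a₃ ^ 2 := by omega
  refine ⟨⟨a₁, a₂, a₃, a₄, a₆⟩, c₄_eq_and_c₆_eq_of_b₂_eq_neg ?_ ?_ ?_⟩
  · simp only [b₂]
    linear_combination -ha₂
  · simp only [b₄]
    linear_combination -ha₄ + 24 * h₁₃
  · simp only [b₆]
    linear_combination -ha₆

end Kraus

section Twist

theorem prime_pow_dvd_pow_mul_iff {M : Type*} [CommMonoidWithZero M] [IsCancelMulZero M]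
    {p t a : M} (hp : Prime p) (ht : ¬ p ∣ t) (n k : ℕ) : p ^ n ∣ t ^ k * a ↔ p ^ n ∣ a :=
  ⟨hp.pow_dvd_of_dvd_mul_left n (mt hp.dvd_of_dvd_pow ht), fun h => h.mul_left _⟩

theorem twist_cube_sub_sq {R : Type*} [CommRing R] (t A B : R) :
    (t ^ 2 * A) ^ 3 - (t ^ 3 * B) ^ 2 = t ^ 6 * (A ^ 3 - B ^ 2) := by
  ring

theorem krausTwo_twist_iff {t A B : ℤ} (ht : 4 ∣ t - 1) :
    KrausTwo (t ^ 2 * A) (t ^ 3 * B) ↔ KrausTwo A B := by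
  have hdvd {a : ℤ} (n k : ℕ) : 2 ^ n ∣ t ^ k * a ↔ 2 ^ n ∣ a :=
    prime_pow_dvd_pow_mul_iff Int.prime_two (by omega) n k
  have h64 : 64 ∣ (t ^ 2 * A) ^ 3 - (t ^ 3 * B) ^ 2 ↔ 64 ∣ A ^ 3 - B ^ 2 := by
    rw [twist_cube_sub_sq]
    exact hdvd 6 6
  have h16 : 16 ∣ t ^ 2 * A ↔ 16 ∣ A := hdvd 4 2
  have h8 : 8 ∣ t ^ 3 * B ↔ 8 ∣ B := hdvd 3 3
  have h32 : 32 ∣ t ^ 3 * B ↔ 32 ∣ B := hdvd 5 3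
  obtain ⟨q, hq⟩ : 4 ∣ t ^ 3 - 1 := by simpa using ht.trans (sub_dvd_pow_sub_pow t 1 3)
  have hB : t ^ 3 * B = 4 * (q * B) + B := by linear_combination B * hq
  have h4 : 4 ∣ t ^ 3 * B + 1 ↔ 4 ∣ B + 1 := by omega
  have h32' : 32 ∣ t ^ 3 * B - 8 ↔ 32 ∣ B - 8 := by
    by_cases hB8 : 8 ∣ B
    · have := hB8.mul_left q
      omega
    · have := mt h8.1 hB8
      omega
  rw [KrausTwo, KrausTwo, h64, h16, h32, h4, h32']

theorem krausThree_twist_iff {t A B : ℤ} (ht : ¬ 3 ∣ t) :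
    KrausThree (t ^ 2 * A) (t ^ 3 * B) ↔ KrausThree A B := by
  have hdvd {a : ℤ} (n k : ℕ) : 3 ^ n ∣ t ^ k * a ↔ 3 ^ n ∣ a :=
    prime_pow_dvd_pow_mul_iff Int.prime_three ht n k
  have h27 : 27 ∣ (t ^ 2 * A) ^ 3 - (t ^ 3 * B) ^ 2 ↔ 27 ∣ A ^ 3 - B ^ 2 := by
    rw [twist_cube_sub_sq]
    exact hdvd 3 6
  have h9 : 9 ∣ t ^ 3 * B ↔ 9 ∣ B := hdvd 2 3
  have h27' : 27 ∣ t ^ 3 * B ↔ 27 ∣ B := hdvd 3 3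
  rw [KrausThree, KrausThree, h27, h9, h27']

theorem kraus_twist_iff {p : ℕ} {t A B : ℤ} (ht : ¬ (p : ℤ) ∣ t) (ht₂ : p = 2 → 4 ∣ t - 1) :
    Kraus p (t ^ 2 * A) (t ^ 3 * B) ↔ Kraus p A B := by
  refine and_congr (imp_congr_right fun hp => krausTwo_twist_iff (ht₂ hp))
    (imp_congr_right fun hp => krausThree_twist_iff ?_)
  subst hp
  exact ht

theorem krausTwo_of_dvd {A B : ℤ} (hA : 16 ∣ A) (hB : 32 ∣ B ∨ 32 ∣ B - 8) : KrausTwo A B := by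
  refine ⟨?_, Or.inr ⟨hA, hB⟩⟩
  obtain ⟨a, rfl⟩ := hA
  obtain ⟨b, rfl⟩ : (8 : ℤ) ∣ B := by omega
  exact ⟨64 * a ^ 3 - b ^ 2, by ring⟩

theorem krausThree_of_dvd {A B : ℤ} (hA : 9 ∣ A) (hB : 27 ∣ B) : KrausThree A B := by
  refine ⟨?_, fun _ => hB⟩
  obtain ⟨a, rfl⟩ := hA
  obtain ⟨b, rfl⟩ := hB
  exact ⟨27 * a ^ 3 - 27 * b ^ 2, by ring⟩

theorem KrausTwo.even_or_odd {A B : ℤ} (h : KrausTwo A B) :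
    ¬ 2 ∣ A ∧ ¬ 2 ∣ B ∨ 16 ∣ A ∧ (32 ∣ B ∨ 32 ∣ B - 8) := by
  obtain ⟨hAB, hB | hAB'⟩ := h
  · refine Or.inl ⟨fun hA => ?_, by omega⟩
    have hA_cube : 2 ∣ A ^ 3 := dvd_pow hA (by norm_num)
    have : (2 : ℤ) ∣ B ^ 2 := by omega
    have := Int.prime_two.dvd_of_dvd_pow this
    omega
  · exact Or.inr hAB'

/-- `(A, B)` is divisible by `(p⁴ʲ, p⁶ʲ)` with quotient satisfying Kraus's condition at `p`. -/
def KrausDiv (p j : ℕ) (A B : ℤ) : Prop :=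
  ∃ a b : ℤ, A = p ^ (4 * j) * a ∧ B = p ^ (6 * j) * b ∧ Kraus p a b

theorem krausDiv_zero_iff {p : ℕ} {A B : ℤ} : KrausDiv p 0 A B ↔ Kraus p A B := by
  simp [KrausDiv]

theorem kraus_two_iff {A B : ℤ} : Kraus 2 A B ↔ KrausTwo A B := by simp [Kraus]

theorem krausDiv_twist_iff {p : ℕ} (hp : p.Prime) {t A B : ℤ} (ht : ¬ (p : ℤ) ∣ t)
    (ht₂ : p = 2 → 4 ∣ t - 1) (j : ℕ) :
    KrausDiv p j (t ^ 2 * A) (t ^ 3 * B) ↔ KrausDiv p j A B := by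
  have hp' := Nat.prime_iff_prime_int.1 hp
  constructor
  · rintro ⟨a, b, ha, hb, h⟩
    obtain ⟨a', rfl⟩ := (prime_pow_dvd_pow_mul_iff hp' ht _ _).1 ⟨a, ha⟩
    obtain ⟨b', rfl⟩ := (prime_pow_dvd_pow_mul_iff hp' ht _ _).1 ⟨b, hb⟩
    rw [mul_left_comm] at ha hb
    rw [← mul_left_cancel₀ (pow_ne_zero _ hp'.ne_zero) ha,
      ← mul_left_cancel₀ (pow_ne_zero _ hp'.ne_zero) hb, kraus_twist_iff ht ht₂] at h
    exact ⟨a', b', rfl, rfl, h⟩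
  · rintro ⟨a, b, rfl, rfl, h⟩
    exact ⟨t ^ 2 * a, t ^ 3 * b, by ring, by ring, (kraus_twist_iff ht ht₂).2 h⟩

end Twist

section IntegralModels

theorem exists_variableChange_of_c₄_of_c₆ {F : Type*} [Field F] (h2 : (2 : F) ≠ 0)
    (h3 : (3 : F) ≠ 0) {W W' : WeierstrassCurve F} (u : Fˣ) (h₄ : u ^ 4 * W'.c₄ = W.c₄)
    (h₆ : u ^ 6 * W'.c₆ = W.c₆) : ∃ C : VariableChange F, C.u = u ∧ C • W = W' := by
  let _ := invertibleOfNonzero h2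
  let _ := invertibleOfNonzero h3
  have u_toShortNF (V : WeierstrassCurve F) : V.toShortNF.u = 1 := by
    simp [toShortNF, toCharNeTwoNF, VariableChange.mul_def]
  have c₄_short (V : WeierstrassCurve F) : V.c₄ = -48 * (V.toShortNF • V).a₄ := by
    rw [← c₄_of_isShortNF, variableChange_c₄, u_toShortNF]
    simp
  have c₆_short (V : WeierstrassCurve F) : V.c₆ = -864 * (V.toShortNF • V).a₆ := by
    rw [← c₆_of_isShortNF, variableChange_c₆, u_toShortNF]
    simp
  have h48 : (48 : F) ≠ 0 := by
    rw [show (48 : F) = 2 ^ 4 * 3 by norm_num]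
    exact mul_ne_zero (pow_ne_zero _ h2) h3
  have h864 : (864 : F) ≠ 0 := by
    rw [show (864 : F) = 2 ^ 5 * 3 ^ 3 by norm_num]
    exact mul_ne_zero (pow_ne_zero _ h2) (pow_ne_zero _ h3)
  let D : VariableChange F := ⟨u, 0, 0, 0⟩
  suffices hD : D • W.toShortNF • W = W'.toShortNF • W' from
    ⟨W'.toShortNF⁻¹ * (D * W.toShortNF), by
      simp [VariableChange.mul_def, VariableChange.inv_def, u_toShortNF, D],
      by rw [mul_smul, mul_smul, hD, inv_smul_smul]⟩
  have hu : (u : F) ≠ 0 := u.ne_zero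
  have h₄' : (W.toShortNF • W).a₄ = u ^ 4 * (W'.toShortNF • W').a₄ :=
    mul_left_cancel₀ h48 (by linear_combination h₄ - u ^ 4 * c₄_short W' + c₄_short W)
  have h₆' : (W.toShortNF • W).a₆ = u ^ 6 * (W'.toShortNF • W').a₆ :=
    mul_left_cancel₀ h864 (by linear_combination h₆ - u ^ 6 * c₆_short W' + c₆_short W)
  generalize hV : W.toShortNF • W = V at h₄' h₆' ⊢
  generalize hV' : W'.toShortNF • W' = V' at h₄' h₆' ⊢
  have : V.IsShortNF := hV ▸ inferInstance
  have : V'.IsShortNF := hV' ▸ inferInstance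
  ext <;> simp [D, variableChange_def, h₄', h₆', hu]

variable {p : ℕ}

theorem intCast_ne_zero_of_not_dvd {m : ℤ} (hm : ¬ (p : ℤ) ∣ m) : (m : ℚ) ≠ 0 :=
  Int.cast_ne_zero.2 fun h => hm (h ▸ dvd_zero _)

theorem not_dvd_den_of_padicValRat_nonneg (hp : p.Prime) {x : ℚ} (h : 0 ≤ padicValRat p x) :
    ¬ p ∣ x.den := by
  have := Fact.mk hp
  rw [← Rat.padicValuation_le_one_iff]
  rcases eq_or_ne x 0 with rfl | hx
  · simp
  · simpa [Rat.padicValuation, hx, ← WithZero.exp_neg, ← WithZero.exp_zero] using h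

theorem not_dvd_den_pow_mul (hp : p.Prime) {x y : ℚ} (hx : ¬ p ∣ x.den) (hy : ¬ p ∣ y.den)
    (n : ℕ) : ¬ p ∣ (x ^ n * y).den := fun h => by
  have := h.trans (Rat.mul_den_dvd _ _)
  rw [Rat.den_pow, hp.dvd_mul] at this
  exact this.elim (mt hp.dvd_of_dvd_pow hx) hy

theorem exists_intCast_eq_pow_mul {x : ℚ} {m : ℤ} (hm : (x.den : ℤ) ∣ m) {n : ℕ} (hn : n ≠ 0) :
    ∃ k : ℤ, (k : ℚ) = m ^ n * x := by
  obtain ⟨e, rfl⟩ := hm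
  obtain ⟨n, rfl⟩ := Nat.exists_eq_add_one_of_ne_zero hn
  refine ⟨(x.den * e) ^ n * e * x.num, ?_⟩
  push_cast
  linear_combination -(x.den * e : ℚ) ^ n * e * x.mul_den_eq_num

theorem exists_forall_den_dvd (hp : p.Prime) {s : Finset ℚ} (hs : ∀ x ∈ s, ¬ p ∣ x.den) :
    ∃ m : ℤ, ¬ (p : ℤ) ∣ m ∧ ∀ x ∈ s, (x.den : ℤ) ∣ m := by
  refine ⟨∏ x ∈ s, (x.den : ℤ), fun h => ?_,
    fun x hx => Finset.dvd_prod_of_mem (fun x : ℚ => (x.den : ℤ)) hx⟩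
  obtain ⟨x, hx, hpx⟩ := (Nat.prime_iff_prime_int.1 hp).exists_mem_finset_dvd h
  exact hs x hx (Int.natCast_dvd_natCast.1 hpx)

@[simp]
theorem baseChange_rat_c₄ (W : WeierstrassCurve ℤ) : (W.baseChange ℚ).c₄ = W.c₄ := by
  simp [baseChange]

@[simp]
theorem baseChange_rat_c₆ (W : WeierstrassCurve ℤ) : (W.baseChange ℚ).c₆ = W.c₆ := by
  simp [baseChange]

/-- `A` and `B` are the invariants `c₄` and `c₆` of a `p`-integral Weierstrass equation. -/
def HasIntegralModelAt (p : ℕ) (A B : ℚ) : Prop :=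
  ∃ W : WeierstrassCurve ℚ, W.IsIntegralAt p ∧ W.c₄ = A ∧ W.c₆ = B

theorem isIntegralAt_baseChange (hp : p.Prime) (W : WeierstrassCurve ℤ) :
    (W.baseChange ℚ).IsIntegralAt p := by
  simp [IsIntegralAt, baseChange, hp.one_lt.ne']

theorem HasIntegralModelAt.of_int (hp : p.Prime) (W : WeierstrassCurve ℤ) :
    HasIntegralModelAt p W.c₄ W.c₆ :=
  ⟨W.baseChange ℚ, isIntegralAt_baseChange hp W, baseChange_rat_c₄ W, baseChange_rat_c₆ W⟩

theorem HasIntegralModelAt.mul (hp : p.Prime) {A B x : ℚ} (h : HasIntegralModelAt p A B)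
    (hx0 : x ≠ 0) (hx : ¬ p ∣ x.den) : HasIntegralModelAt p (x ^ 4 * A) (x ^ 6 * B) := by
  obtain ⟨W, ⟨h₁, h₂, h₃, h₄, h₆⟩, rfl, rfl⟩ := h
  refine ⟨(⟨(Units.mk0 x hx0)⁻¹, 0, 0, 0⟩ : VariableChange ℚ) • W, ?_,
    by simp [variableChange_c₄], by simp [variableChange_c₆]⟩
  simpa [IsIntegralAt, variableChange_def] using
    ⟨by simpa using not_dvd_den_pow_mul hp hx h₁ 1, not_dvd_den_pow_mul hp hx h₂ 2,
      not_dvd_den_pow_mul hp hx h₃ 3, not_dvd_den_pow_mul hp hx h₄ 4,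
      not_dvd_den_pow_mul hp hx h₆ 6⟩

theorem HasIntegralModelAt.exists_int (hp : p.Prime) {A B : ℚ} (h : HasIntegralModelAt p A B) :
    ∃ (W : WeierstrassCurve ℤ) (m : ℤ), ¬ (p : ℤ) ∣ m ∧ W.c₄ = m ^ 4 * A ∧ W.c₆ = m ^ 6 * B := by
  obtain ⟨W, ⟨h₁, h₂, h₃, h₄, h₆⟩, rfl, rfl⟩ := h
  let coeffs : Finset ℚ := {W.a₁, W.a₂, W.a₃, W.a₄, W.a₆}
  obtain ⟨m, hpm, hm⟩ := exists_forall_den_dvd hp (s := coeffs) (by simp [coeffs, *])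
  have hm0 : (m : ℚ) ≠ 0 := intCast_ne_zero_of_not_dvd hpm
  have exists_int {x : ℚ} (hx : x ∈ coeffs) {n : ℕ} (hn : n ≠ 0) : ∃ k : ℤ, (k : ℚ) = m ^ n * x :=
    exists_intCast_eq_pow_mul (hm x hx) hn
  obtain ⟨n₁, e₁⟩ := exists_int (x := W.a₁) (by simp [coeffs]) one_ne_zero
  obtain ⟨n₂, e₂⟩ := exists_int (x := W.a₂) (by simp [coeffs]) two_ne_zero
  obtain ⟨n₃, e₃⟩ := exists_int (x := W.a₃) (by simp [coeffs]) three_ne_zero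
  obtain ⟨n₄, e₄⟩ := exists_int (x := W.a₄) (by simp [coeffs]) four_ne_zero
  obtain ⟨n₆, e₆⟩ := exists_int (x := W.a₆) (n := 6) (by simp [coeffs]) (by norm_num)
  have hW : (⟨n₁, n₂, n₃, n₄, n₆⟩ : WeierstrassCurve ℤ).baseChange ℚ =
      (⟨(Units.mk0 (m : ℚ) hm0)⁻¹, 0, 0, 0⟩ : VariableChange ℚ) • W := by
    ext <;> simp [baseChange, variableChange_def, *]
  refine ⟨⟨n₁, n₂, n₃, n₄, n₆⟩, m, hpm, ?_, ?_⟩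
  · rw [← baseChange_rat_c₄, hW, variableChange_c₄]
    simp
  · rw [← baseChange_rat_c₆, hW, variableChange_c₆]
    simp

theorem not_dvd_two_mul_three (hp : p.Prime) (hp2 : p ≠ 2) (hp3 : p ≠ 3) :
    ¬ (p : ℤ) ∣ 2 * 3 := by
  rw [(Nat.prime_iff_prime_int.1 hp).dvd_mul, not_or]
  norm_cast
  rw [Nat.prime_dvd_prime_iff_eq hp Nat.prime_two, Nat.prime_dvd_prime_iff_eq hp Nat.prime_three]
  exact ⟨hp2, hp3⟩

theorem HasIntegralModelAt.krausDiv (hp : p.Prime) {A B : ℤ} {j : ℕ}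
    (h : HasIntegralModelAt p (A / (p ^ j) ^ 4) (B / (p ^ j) ^ 6)) : KrausDiv p j A B := by
  obtain ⟨W, m, hm, h₄, h₆⟩ := h.exists_int hp
  have hp0 : (p : ℚ) ≠ 0 := by exact_mod_cast hp.ne_zero
  have hm₂ : p = 2 → 4 ∣ m ^ 2 - 1 := by
    rintro rfl
    have := Int.eight_dvd_sq_sub_one_of_odd (Int.odd_iff.2 (by omega : m % 2 = 1))
    omega
  rw [← krausDiv_twist_iff hp (mt (Nat.prime_iff_prime_int.1 hp).dvd_of_dvd_pow hm) hm₂]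
  refine ⟨W.c₄, W.c₆, ?_, ?_, kraus_invariants p W⟩
  · field_simp at h₄
    have : (p ^ (4 * j) * W.c₄ : ℚ) = (m ^ 2) ^ 2 * A := by linear_combination h₄
    exact_mod_cast this.symm
  · field_simp at h₆
    have : (p ^ (6 * j) * W.c₆ : ℚ) = (m ^ 2) ^ 3 * B := by linear_combination h₆
    exact_mod_cast this.symm

theorem exists_krausTwo_and_krausThree (hp : p.Prime) {A B : ℤ} (h : Kraus p A B) :
    ∃ m : ℤ, ¬ (p : ℤ) ∣ m ∧ KrausTwo (m ^ 4 * A) (m ^ 6 * B) ∧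
      KrausThree (m ^ 4 * A) (m ^ 6 * B) := by
  have krausTwo (k : ℤ) : KrausTwo ((2 * k) ^ 4 * A) ((2 * k) ^ 6 * B) :=
    krausTwo_of_dvd ⟨k ^ 4 * A, by ring⟩ (Or.inl ⟨2 * k ^ 6 * B, by ring⟩)
  have krausThree (k : ℤ) : KrausThree ((3 * k) ^ 4 * A) ((3 * k) ^ 6 * B) :=
    krausThree_of_dvd ⟨9 * k ^ 4 * A, by ring⟩ ⟨27 * k ^ 6 * B, by ring⟩
  by_cases hp2 : p = 2
  · subst hp2
    refine ⟨3 * 1, by norm_num, ?_, krausThree 1⟩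
    convert (krausTwo_twist_iff (t := 3 ^ 2) (by norm_num)).2 (h.1 rfl) using 1 <;> ring
  by_cases hp3 : p = 3
  · subst hp3
    refine ⟨2 * 1, by norm_num, krausTwo 1, ?_⟩
    convert (krausThree_twist_iff (t := 2 ^ 2) (by norm_num)).2 (h.2 rfl) using 1 <;> ring
  exact ⟨2 * 3, not_dvd_two_mul_three hp hp2 hp3, krausTwo 3, krausThree 2⟩

theorem not_dvd_den_inv_intCast {m : ℤ} (hm : ¬ (p : ℤ) ∣ m) :
    ¬ p ∣ ((m : ℚ)⁻¹).den := by
  rw [Rat.inv_intCast_den, if_neg (Int.cast_ne_zero.1 (intCast_ne_zero_of_not_dvd hm))]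
  rwa [← Int.natCast_dvd]

theorem Kraus.hasIntegralModelAt (hp : p.Prime) {A B : ℤ} (h : Kraus p A B) :
    HasIntegralModelAt p A B := by
  obtain ⟨m, hm, h₂, h₃⟩ := exists_krausTwo_and_krausThree hp h
  obtain ⟨W, h₄, h₆⟩ := exists_of_krausTwo_of_krausThree h₂ h₃
  have hm0 : (m : ℚ) ≠ 0 := intCast_ne_zero_of_not_dvd hm
  convert (HasIntegralModelAt.of_int hp W).mul hp (inv_ne_zero hm0)
    (not_dvd_den_inv_intCast hm) using 1 <;> simp [h₄, h₆, field]

theorem HasIntegralModelAt.twist (hp : p.Prime) {A B : ℚ} {t : ℤ} (ht : ¬ (p : ℤ) ∣ t)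
    (ht₂ : p = 2 → 4 ∣ t - 1) (h : HasIntegralModelAt p A B) :
    HasIntegralModelAt p (t ^ 2 * A) (t ^ 3 * B) := by
  obtain ⟨W, m, hm, h₄, h₆⟩ := h.exists_int hp
  have hm0 : (m : ℚ) ≠ 0 := intCast_ne_zero_of_not_dvd hm
  convert (((kraus_twist_iff ht ht₂).2 (kraus_invariants p W)).hasIntegralModelAt hp).mul hp
    (inv_ne_zero hm0) (not_dvd_den_inv_intCast hm) using 1 <;> simp [h₄, h₆, field]

theorem hasIntegralModelAt_twist_iff (hp : p.Prime) {A B : ℚ} {t : ℤ} (ht : ¬ (p : ℤ) ∣ t)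
    (ht₂ : p = 2 → 4 ∣ t - 1) :
    HasIntegralModelAt p (t ^ 2 * A) (t ^ 3 * B) ↔ HasIntegralModelAt p A B := by
  refine ⟨fun h => ?_, HasIntegralModelAt.twist hp ht ht₂⟩
  have ht0 : (t : ℚ) ≠ 0 := intCast_ne_zero_of_not_dvd ht
  convert (h.twist hp ht ht₂).mul hp (inv_ne_zero ht0) (not_dvd_den_inv_intCast ht) using 1 <;>
    field_simp

theorem hasIntegralModelAt_div_pow_iff (hp : p.Prime) {A B : ℤ} {j : ℕ} :
    HasIntegralModelAt p (A / (p ^ j) ^ 4) (B / (p ^ j) ^ 6) ↔ KrausDiv p j A B := by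
  refine ⟨HasIntegralModelAt.krausDiv hp, ?_⟩
  rintro ⟨a, b, rfl, rfl, h⟩
  have hp0 : (p : ℚ) ≠ 0 := by exact_mod_cast hp.ne_zero
  convert h.hasIntegralModelAt hp using 1
  · push_cast
    field_simp
    ring
  · push_cast
    field_simp
    ring

theorem hasIntegralModelAt_iff_kraus (hp : p.Prime) {A B : ℤ} :
    HasIntegralModelAt p A B ↔ Kraus p A B := by
  simpa [krausDiv_zero_iff] using hasIntegralModelAt_div_pow_iff hp (A := A) (B := B) (j := 0)

theorem exists_intCast_eq {x : ℚ} (h : ∀ p : ℕ, p.Prime → ¬ p ∣ x.den) : ∃ n : ℤ, (n : ℚ) = x :=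
  ⟨x.num, Rat.coe_int_num_of_den_eq_one (Nat.eq_one_iff_not_exists_prime_dvd.2 h)⟩

theorem HasIntegralModelAt.not_dvd_den (hp : p.Prime) {A B : ℚ} (h : HasIntegralModelAt p A B) :
    ¬ p ∣ A.den ∧ ¬ p ∣ B.den := by
  have not_dvd {x : ℚ} {m k : ℤ} (n : ℕ) (hm : ¬ (p : ℤ) ∣ m) (hx : (k : ℚ) = m ^ n * x) :
      ¬ p ∣ x.den := by
    have hm0 : (m : ℚ) ≠ 0 := intCast_ne_zero_of_not_dvd hm
    obtain rfl : x = (m : ℚ)⁻¹ ^ n * k := by simp [hx, field]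
    exact not_dvd_den_pow_mul hp (not_dvd_den_inv_intCast hm) (by simp [hp.one_lt.ne']) n
  obtain ⟨W, m, hm, h₄, h₆⟩ := h.exists_int hp
  exact ⟨not_dvd 4 hm h₄, not_dvd 6 hm h₆⟩

theorem exists_of_forall_hasIntegralModelAt {A B : ℚ}
    (h : ∀ p : ℕ, p.Prime → HasIntegralModelAt p A B) :
    ∃ W : WeierstrassCurve ℤ, W.c₄ = A ∧ W.c₆ = B := by
  obtain ⟨A, rfl⟩ := exists_intCast_eq fun p hp => ((h p hp).not_dvd_den hp).1
  obtain ⟨B, rfl⟩ := exists_intCast_eq fun p hp => ((h p hp).not_dvd_den hp).2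
  obtain ⟨W, h₄, h₆⟩ := exists_of_krausTwo_of_krausThree
    (((hasIntegralModelAt_iff_kraus Nat.prime_two).1 (h 2 Nat.prime_two)).1 rfl)
    (((hasIntegralModelAt_iff_kraus Nat.prime_three).1 (h 3 Nat.prime_three)).2 rfl)
  exact ⟨W, by rw [h₄], by rw [h₆]⟩

end IntegralModels

section Minimality

variable {p : ℕ}

/-- `A` and `B` are the invariants `c₄` and `c₆` of a `p`-integral Weierstrass equation, and no
rescaling by a power of `p` leads to a `p`-integral equation of smaller discriminant. -/
def HasMinimalModelAt (p : ℕ) (A B : ℚ) : Prop :=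
  HasIntegralModelAt p A B ∧ ¬ HasIntegralModelAt p (A / p ^ 4) (B / p ^ 6)

theorem padicValRat_variableChange_Δ [Fact p.Prime] {W : WeierstrassCurve ℚ} (hΔ : W.Δ ≠ 0)
    (C : VariableChange ℚ) :
    padicValRat p (C • W).Δ = padicValRat p W.Δ - 12 * padicValRat p (C.u : ℚ) := by
  rw [variableChange_Δ, padicValRat.mul (pow_ne_zero _ (Units.ne_zero _)) hΔ, padicValRat.pow,
    Units.val_inv_eq_inv_val, padicValRat.inv]
  push_cast
  ring

theorem forall_padicValRat_Δ_le_iff (hp : p.Prime) {W : WeierstrassCurve ℚ} (hΔ : W.Δ ≠ 0) :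
    (∀ C : VariableChange ℚ, (C • W).IsIntegralAt p → padicValRat p W.Δ ≤ padicValRat p (C • W).Δ) ↔
      ¬ HasIntegralModelAt p (W.c₄ / p ^ 4) (W.c₆ / p ^ 6) := by
  have := Fact.mk hp
  have hp0 : (p : ℚ) ≠ 0 := by exact_mod_cast hp.ne_zero
  constructor
  · rintro hmin ⟨W', hW', h₄, h₆⟩
    obtain ⟨C, hC, rfl⟩ := exists_variableChange_of_c₄_of_c₆ two_ne_zero three_ne_zero
      (Units.mk0 (p : ℚ) hp0) (W := W) (W' := W') (by simp [h₄, field]) (by simp [h₆, field])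
    have := hmin C hW'
    rw [padicValRat_variableChange_Δ hΔ, hC, Units.val_mk0, padicValRat.self hp.one_lt] at this
    omega
  · intro h C hC
    by_contra! hlt
    rw [padicValRat_variableChange_Δ hΔ] at hlt
    have hu0 : (C.u : ℚ) ≠ 0 := C.u.ne_zero
    have hu : 0 ≤ padicValRat p (C.u / p : ℚ) := by
      rw [padicValRat.div hu0 hp0, padicValRat.self hp.one_lt]
      omega
    apply h
    convert HasIntegralModelAt.mul hp ⟨C • W, hC, rfl, rfl⟩ (div_ne_zero hu0 hp0)
      (not_dvd_den_of_padicValRat_nonneg hp hu) using 1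
    · rw [variableChange_c₄, Units.val_inv_eq_inv_val]
      field_simp
    · rw [variableChange_c₆, Units.val_inv_eq_inv_val]
      field_simp

theorem hasMinimalModelAt_of_isGlobalMinimal (hp : p.Prime) {W : WeierstrassCurve ℚ}
    (h : W.IsGlobalMinimal) : HasMinimalModelAt p W.c₄ W.c₆ := by
  refine ⟨?_, (forall_padicValRat_Δ_le_iff hp h.isElliptic.isUnit.ne_zero).1 (h.minimal p hp)⟩
  obtain ⟨E, rfl⟩ := h.isIntegral
  exact ⟨_, isIntegralAt_baseChange hp E, rfl, rfl⟩

theorem exists_isGlobalMinimal {W : WeierstrassCurve ℚ} (hΔ : W.Δ ≠ 0) (u : ℚˣ)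
    (h : ∀ p : ℕ, p.Prime → HasMinimalModelAt p (W.c₄ / u ^ 4) (W.c₆ / u ^ 6)) :
    ∃ r s t : ℚ, ((⟨u, r, s, t⟩ : VariableChange ℚ) • W).IsGlobalMinimal := by
  obtain ⟨E, h₄, h₆⟩ := exists_of_forall_hasIntegralModelAt fun p hp => (h p hp).1
  obtain ⟨⟨u, r, s, t⟩, rfl, hE⟩ := exists_variableChange_of_c₄_of_c₆ two_ne_zero three_ne_zero
    u (W := W) (W' := E.baseChange ℚ) (by simp [h₄, field]) (by simp [h₆, field])
  have hΔE : (E.baseChange ℚ).Δ ≠ 0 := by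
    rw [← hE, variableChange_Δ]
    exact mul_ne_zero (pow_ne_zero _ (Units.ne_zero _)) hΔ
  refine ⟨r, s, t, hE ▸ ⟨⟨isUnit_iff_ne_zero.2 hΔE⟩, ⟨E, rfl⟩, fun p hp => ?_⟩⟩
  rw [forall_padicValRat_Δ_le_iff hp hΔE, baseChange_rat_c₄, baseChange_rat_c₆, h₄, h₆]
  exact (h p hp).2

theorem hasMinimalModelAt_div_pow_iff (hp : p.Prime) {A B : ℤ} {j : ℕ} :
    HasMinimalModelAt p (A / (p ^ j) ^ 4) (B / (p ^ j) ^ 6) ↔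
      KrausDiv p j A B ∧ ¬ KrausDiv p (j + 1) A B := by
  rw [← hasIntegralModelAt_div_pow_iff hp, ← hasIntegralModelAt_div_pow_iff hp,
    HasMinimalModelAt, div_div, div_div, ← mul_pow, ← mul_pow, ← pow_succ]

theorem hasMinimalModelAt_two_pow_mul_iff {A B : ℤ} :
    HasMinimalModelAt 2 (2 ^ 4 * A) (2 ^ 6 * B) ↔ ¬ KrausTwo A B := by
  rw [← kraus_two_iff, ← hasIntegralModelAt_iff_kraus Nat.prime_two, HasMinimalModelAt]
  have hKraus : KrausTwo (2 ^ 4 * A) (2 ^ 6 * B) :=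
    krausTwo_of_dvd ⟨A, by ring⟩ (Or.inl ⟨2 * B, by ring⟩)
  have hIntegral : HasIntegralModelAt 2 (2 ^ 4 * A) (2 ^ 6 * B) := by
    exact_mod_cast (kraus_two_iff.2 hKraus).hasIntegralModelAt Nat.prime_two
  simp [hIntegral]

theorem hasMinimalModelAt_twist_iff (hp : p.Prime) {A B : ℚ} {t : ℤ} (ht : ¬ (p : ℤ) ∣ t)
    (ht₂ : p = 2 → 4 ∣ t - 1) :
    HasMinimalModelAt p (t ^ 2 * A) (t ^ 3 * B) ↔ HasMinimalModelAt p A B := by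
  rw [HasMinimalModelAt, mul_div_assoc, mul_div_assoc, hasIntegralModelAt_twist_iff hp ht ht₂,
    hasIntegralModelAt_twist_iff hp ht ht₂, ← HasMinimalModelAt]

theorem HasMinimalModelAt.mul (hp : p.Prime) {A B x : ℚ} (h : HasMinimalModelAt p A B)
    (hx0 : x ≠ 0) (hx : padicValRat p x = 0) : HasMinimalModelAt p (x ^ 4 * A) (x ^ 6 * B) := by
  have := Fact.mk hp
  refine ⟨h.1.mul hp hx0 (not_dvd_den_of_padicValRat_nonneg hp hx.ge), fun h' => h.2 ?_⟩
  have hx' : padicValRat p x⁻¹ = 0 := by rw [padicValRat.inv, hx, neg_zero]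
  convert h'.mul hp (inv_ne_zero hx0) (not_dvd_den_of_padicValRat_nonneg hp hx'.ge) using 1 <;>
    field_simp

end Minimality

section TwistAtOdd

variable {p : ℕ}

theorem kraus_iff_of_ne_two (hp2 : p ≠ 2) {A B : ℤ} :
    Kraus p A B ↔ (p = 3 → KrausThree A B) := by simp [Kraus, hp2]

theorem kraus_twist_self (hp2 : p ≠ 2) (A B : ℤ) : Kraus p (p ^ 2 * A) (p ^ 3 * B) := by
  rw [kraus_iff_of_ne_two hp2]
  rintro rfl
  exact krausThree_of_dvd ⟨A, by norm_num⟩ ⟨B, by norm_num⟩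

theorem krausDiv_one_twist_self (hp2 : p ≠ 2) {A B D : ℤ} (hD : A ^ 3 - B ^ 2 = 1728 * D)
    (h : (p : ℤ) ^ 2 ∣ A ∧ (p : ℤ) ^ 3 ∣ B ∧ (p : ℤ) ^ 6 ∣ D)
    (h' : ¬ (p = 3 ∧ (p : ℤ) ^ 5 ∣ B ∧ ¬ (p : ℤ) ^ 6 ∣ B)) :
    KrausDiv p 1 (p ^ 2 * A) (p ^ 3 * B) := by
  obtain ⟨⟨a, rfl⟩, ⟨b, rfl⟩, ⟨e, rfl⟩⟩ := h
  refine ⟨a, b, by ring, by ring, (kraus_iff_of_ne_two hp2).2 ?_⟩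
  rintro rfl
  norm_num at hD h'
  exact ⟨⟨64 * e, by linarith⟩, by omega⟩

theorem krausDiv_one_twist_self_iff (hp : p.Prime) (hp2 : p ≠ 2) {A B D : ℤ}
    (hD : A ^ 3 - B ^ 2 = 1728 * D) :
    KrausDiv p 1 (p ^ 2 * A) (p ^ 3 * B) ↔
      ((p : ℤ) ^ 2 ∣ A ∧ (p : ℤ) ^ 3 ∣ B ∧ (p : ℤ) ^ 6 ∣ D) ∧
        ¬ (p = 3 ∧ (p : ℤ) ^ 5 ∣ B ∧ ¬ (p : ℤ) ^ 6 ∣ B) := by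
  have hp' := Nat.prime_iff_prime_int.1 hp
  refine ⟨?_, fun h => krausDiv_one_twist_self hp2 hD h.1 h.2⟩
  rintro ⟨a, b, ha, hb, h⟩
  obtain rfl : A = p ^ 2 * a :=
    mul_left_cancel₀ (pow_ne_zero 2 hp'.ne_zero) (ha.trans (by ring))
  obtain rfl : B = p ^ 3 * b :=
    mul_left_cancel₀ (pow_ne_zero 3 hp'.ne_zero) (hb.trans (by ring))
  rw [kraus_iff_of_ne_two hp2] at h
  have hD' : (p : ℤ) ^ 6 * (a ^ 3 - b ^ 2) = 1728 * D := by rw [← hD]; ring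
  by_cases hp3 : p = 3
  · subst hp3
    obtain ⟨⟨e, he⟩, h9⟩ := h rfl
    rw [he] at hD'
    norm_num at hD' ⊢
    omega
  · have h12 : ¬ (p : ℤ) ∣ 12 := fun h => not_dvd_two_mul_three hp hp2 hp3
      (hp'.dvd_of_dvd_pow (h.trans (by norm_num : (12 : ℤ) ∣ (2 * 3) ^ 2)))
    have hpD : (p : ℤ) ^ 6 ∣ D :=
      (prime_pow_dvd_pow_mul_iff hp' h12 6 3).1 ⟨a ^ 3 - b ^ 2, by linear_combination -hD'⟩
    exact ⟨⟨dvd_mul_right _ _, dvd_mul_right _ _, hpD⟩, fun h => hp3 h.1⟩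

theorem not_krausDiv_two_twist_self (hp : p.Prime) (hp2 : p ≠ 2) {A B : ℤ}
    (h : ¬ KrausDiv p 1 A B) : ¬ KrausDiv p 2 (p ^ 2 * A) (p ^ 3 * B) := by
  have hp0 : (p : ℤ) ≠ 0 := by exact_mod_cast hp.ne_zero
  rintro ⟨a, b, ha, hb, -⟩
  obtain rfl : A = p ^ 6 * a := mul_left_cancel₀ (pow_ne_zero 2 hp0) (ha.trans (by ring))
  obtain rfl : B = p ^ 9 * b := mul_left_cancel₀ (pow_ne_zero 3 hp0) (hb.trans (by ring))
  exact h ⟨p ^ 2 * a, p ^ 3 * b, by ring, by ring, kraus_twist_self hp2 a b⟩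

theorem pval_eq_ofNat_iff {k : ℕ} [k.AtLeastTwo] {n : ℤ} :
    pval p n = ofNat(k) ↔ (p : ℤ) ^ k ∣ n ∧ ¬ (p : ℤ) ^ (k + 1) ∣ n :=
  emultiplicity_eq_coe

theorem ofNat_le_pval_iff {k : ℕ} [k.AtLeastTwo] {n : ℤ} :
    ofNat(k) ≤ pval p n ↔ (p : ℤ) ^ k ∣ n :=
  pow_dvd_iff_le_emultiplicity.symm

theorem six_le_min_iff {A B D : ℤ} :
    6 ≤ min (3 * pval p A) (min (2 * pval p B) (pval p D)) ↔
      (p : ℤ) ^ 2 ∣ A ∧ (p : ℤ) ^ 3 ∣ B ∧ (p : ℤ) ^ 6 ∣ D := by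
  have h₂ (x : ℕ∞) : 6 ≤ 3 * x ↔ 2 ≤ x := by
    rw [← ENat.mul_le_mul_left_iff (a := 3) (x := 2) (by simp) (by simp)]
    norm_num
  have h₃ (x : ℕ∞) : 6 ≤ 2 * x ↔ 3 ≤ x := by
    rw [← ENat.mul_le_mul_left_iff (a := 2) (x := 3) (by simp) (by simp)]
    norm_num
  simp only [le_min_iff, h₂, h₃, ofNat_le_pval_iff]

open Classical in
theorem oddFactor_eq {E : WeierstrassCurve ℤ} {d : ℤ} (hp : p.Prime) (hp2 : p ≠ 2)
    (hd : (p : ℤ) ∣ d) :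
    oddFactor E d p = if KrausDiv p 1 (p ^ 2 * E.c₄) (p ^ 3 * E.c₆) then (p : ℚ) else 1 := by
  simp only [krausDiv_one_twist_self_iff hp hp2 E.c_relation.symm, ← six_le_min_iff, oddFactor,
    if_pos hd, ← pval_eq_ofNat_iff, ← not_lt, ← not_or, ite_not]

theorem hasMinimalModelAt_oddFactor {E : WeierstrassCurve ℤ} {d : ℤ} (hp : p.Prime) (hp2 : p ≠ 2)
    (hd : Squarefree d) (hE : HasMinimalModelAt p E.c₄ E.c₆) :
    HasMinimalModelAt p (d ^ 2 * E.c₄ / oddFactor E d p ^ 4)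
      (d ^ 3 * E.c₆ / oddFactor E d p ^ 6) := by
  have hp' := Nat.prime_iff_prime_int.1 hp
  have hmin : ¬ KrausDiv p 1 E.c₄ E.c₆ := by simpa using
    ((hasMinimalModelAt_div_pow_iff hp (j := 0)).1 (by simpa using hE)).2
  by_cases hpd : (p : ℤ) ∣ d
  · rw [oddFactor_eq hp hp2 hpd]
    obtain ⟨w, rfl⟩ := hpd
    have hw : ¬ (p : ℤ) ∣ w := fun ⟨v, hv⟩ => hp'.not_isUnit (hd p ⟨v, by rw [hv, mul_assoc]⟩)
    have key (u : ℚ) : HasMinimalModelAt p (((p * w : ℤ) : ℚ) ^ 2 * E.c₄ / u ^ 4)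
        (((p * w : ℤ) : ℚ) ^ 3 * E.c₆ / u ^ 6) ↔
        HasMinimalModelAt p ((p ^ 2 * E.c₄ : ℤ) / u ^ 4) ((p ^ 3 * E.c₆ : ℤ) / u ^ 6) := by
      convert hasMinimalModelAt_twist_iff hp hw (absurd · hp2) using 2 <;> push_cast <;> ring
    rw [key]
    split_ifs with h
    · simpa only [pow_one] using (hasMinimalModelAt_div_pow_iff hp (j := 1)).2
        ⟨h, not_krausDiv_two_twist_self hp hp2 hmin⟩
    · simpa only [pow_zero] using (hasMinimalModelAt_div_pow_iff hp (j := 0)).2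
        ⟨krausDiv_zero_iff.2 (kraus_twist_self hp2 _ _), h⟩
  · simpa [oddFactor, hpd] using (hasMinimalModelAt_twist_iff hp hpd (absurd · hp2)).2 hE

end TwistAtOdd

section TwistAtTwo

variable {A B D s : ℤ}

theorem krausDiv_two_one_of_dvd (hA : 2 ^ 8 ∣ A) (hB : 2 ^ 11 ∣ B) : KrausDiv 2 1 A B := by
  obtain ⟨a, rfl⟩ := hA
  obtain ⟨b, rfl⟩ := hB
  exact ⟨16 * a, 32 * b, by norm_num; ring, by norm_num; ring,
    kraus_two_iff.2 (krausTwo_of_dvd (by omega) (by omega))⟩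

theorem krausTwo_neg_iff (h : KrausTwo A B) : KrausTwo A (-B) ↔ 16 ∣ A ∧ 32 ∣ B := by
  refine ⟨fun h' => ?_, fun h' => krausTwo_of_dvd h'.1 (by omega)⟩
  have := h.2
  have := h'.2
  omega

theorem not_two_dvd_of_eight_dvd (hD : A ^ 3 - B ^ 2 = 1728 * D) (hA : 16 ∣ A) (hB : 8 ∣ B)
    (hB' : ¬ 16 ∣ B) : ¬ 2 ∣ D := by
  obtain ⟨a, rfl⟩ := hA
  obtain ⟨b, rfl⟩ : ∃ b, B = 8 * (2 * b + 1) := ⟨B / 16, by omega⟩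
  have : 27 * D = 2 * (32 * a ^ 3 - 2 * b ^ 2 - 2 * b) - 1 := by linarith
  omega

theorem not_krausTwo_neg_iff (h : KrausTwo A B) (hD : A ^ 3 - B ^ 2 = 1728 * D) :
    ¬ KrausTwo A (-B) ↔ ¬ 2 ∣ A ∧ ¬ 2 ∣ B ∨ 16 ∣ A ∧ (8 ∣ B ∧ ¬ 16 ∣ B) ∧ ¬ 2 ∣ D := by
  rw [krausTwo_neg_iff h]
  have := h.even_or_odd
  have := not_two_dvd_of_eight_dvd hD
  omega

theorem dvd_cube_sub_sq_iff {a b : ℤ} {m : ℕ} (hD : 2 ^ m * (a ^ 3 - b ^ 2) = 1728 * D) :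
    64 ∣ a ^ 3 - b ^ 2 ↔ 2 ^ m ∣ D := by
  constructor
  · rintro ⟨e, he⟩
    rw [he] at hD
    exact (IsCoprime.pow_left (by norm_num : IsCoprime (2 : ℤ) 27)).dvd_of_dvd_mul_left
      ⟨e, by linarith⟩
  · rintro ⟨e, rfl⟩
    exact ⟨27 * e, mul_left_cancel₀ (pow_ne_zero m two_ne_zero) (hD.trans (by ring))⟩

theorem krausDiv_two_one_neg_iff (hD : A ^ 3 - B ^ 2 = 1728 * D) (hmin : ¬ KrausDiv 2 1 A B) :
    KrausDiv 2 1 A (-B) ↔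
      (16 ∣ A ∧ ¬ 32 ∣ A) ∧ (64 ∣ B ∧ ¬ 128 ∣ B) ∧ 4096 ∣ D ∧ B / 64 % 4 = 1 ∨
      256 ∣ A ∧ (512 ∣ B ∧ ¬ 1024 ∣ B) ∧ (4096 ∣ D ∧ ¬ 8192 ∣ D) ∧ B / 512 % 4 = 3 := by
  constructor
  · rintro ⟨a, b, ha, hb, hab⟩
    obtain rfl : A = 16 * a := by simpa using ha
    obtain rfl : B = 64 * -b := by norm_num at hb; omega
    rw [kraus_two_iff] at hab
    have hD' := (dvd_cube_sub_sq_iff (m := 12) (D := D) (by linarith)).1 hab.1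
    rcases hab.even_or_odd with hodd | ⟨ha16, hb⟩
    · have := hab.2
      omega
    · have hb8 : 32 ∣ b - 8 := hb.resolve_left fun hb =>
        hmin (krausDiv_two_one_of_dvd (by omega) (by omega))
      obtain ⟨x, rfl⟩ := ha16
      obtain ⟨y, hy⟩ := hb8
      obtain rfl : b = 8 * (4 * y + 1) := by omega
      have : 27 * D = 4096 * (2 * (32 * x ^ 3 - 8 * y ^ 2 - 4 * y) - 1) := by linarith
      omega
  · rintro (⟨⟨⟨a, rfl⟩, -⟩, ⟨⟨b, rfl⟩, -⟩, hD', h⟩ | ⟨⟨a, rfl⟩, ⟨⟨b, rfl⟩, -⟩, -, h⟩)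
    · refine ⟨a, -b, by norm_num, by norm_num, kraus_two_iff.2 ⟨?_, by omega⟩⟩
      exact (dvd_cube_sub_sq_iff (m := 12) (by linarith)).2 hD'
    · exact ⟨16 * a, -(8 * b), by norm_num; ring, by norm_num; ring,
        kraus_two_iff.2 (krausTwo_of_dvd (by omega) (by omega))⟩

theorem not_krausDiv_two_two_neg (hmin : ¬ KrausDiv 2 1 A B) : ¬ KrausDiv 2 2 A (-B) := by
  rintro ⟨a, b, ha, hb, -⟩
  norm_num at ha hb
  exact hmin (krausDiv_two_one_of_dvd (by omega) (by omega))

theorem krausTwo_four_mul_iff (h : KrausTwo A B) :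
    KrausTwo (4 * A) (8 * (s * B)) ↔ ¬ (¬ 2 ∣ A ∧ ¬ 2 ∣ B) := by
  constructor
  · intro h'
    have := h'.2
    omega
  · intro hAB
    have hAB' := h.even_or_odd.resolve_left hAB
    obtain ⟨c, hc⟩ : 8 ∣ s * B := Dvd.dvd.mul_left (by omega) s
    exact krausTwo_of_dvd (by omega) (by omega)

theorem krausDiv_two_one_four_mul_iff (hs : s = 1 ∨ s = -1) (h : KrausTwo A B) :
    KrausDiv 2 1 (4 * A) (8 * (s * B)) ↔ 64 ∣ A ∧ (256 ∣ B ∨ 256 ∣ B - s * 64) := by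
  constructor
  · rintro ⟨a, b, ha, hb, hab⟩
    norm_num at ha hb
    have := h.even_or_odd
    have := (kraus_two_iff.1 hab).even_or_odd
    rcases hs with rfl | rfl <;> omega
  · rintro ⟨⟨a, rfl⟩, hB⟩
    obtain ⟨b, rfl⟩ : 64 ∣ B := by omega
    refine ⟨16 * a, 8 * (s * b), by norm_num; ring, by norm_num; ring,
      kraus_two_iff.2 (krausTwo_of_dvd (by omega) ?_)⟩
    rcases hs with rfl | rfl <;> omega

theorem dvd_and_not_dvd_of_sixtyFour_dvd (hD : A ^ 3 - B ^ 2 = 1728 * D) (hA : 64 ∣ A) (hB : 64 ∣ B)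
    (hB' : ¬ 128 ∣ B) : 64 ∣ D ∧ ¬ 128 ∣ D := by
  obtain ⟨a, rfl⟩ := hA
  obtain ⟨b, rfl⟩ : ∃ b, B = 64 * (2 * b + 1) := ⟨B / 128, by omega⟩
  have : 27 * D = 64 * (2 * (32 * a ^ 3 - 2 * b ^ 2 - 2 * b) - 1) := by linarith
  omega

theorem not_krausDiv_two_one_four_mul_iff (hs : s = 1 ∨ s = -1) (h : KrausTwo A B)
    (hD : A ^ 3 - B ^ 2 = 1728 * D) (hAB : ¬ (¬ 2 ∣ A ∧ ¬ 2 ∣ B)) :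
    ¬ KrausDiv 2 1 (4 * A) (8 * (s * B)) ↔
      (16 ∣ A ∧ ¬ 32 ∣ A ∨ 32 ∣ A ∧ ¬ 64 ∣ A) ∨
      (8 ∣ B ∧ ¬ 16 ∣ B ∨ 32 ∣ B ∧ ¬ 64 ∣ B ∨ 128 ∣ B ∧ ¬ 256 ∣ B) ∨
      64 ∣ A ∧ (64 ∣ B ∧ ¬ 128 ∣ B) ∧ (64 ∣ D ∧ ¬ 128 ∣ D) ∧ s * (B / 64) % 4 = 3 := by
  rw [krausDiv_two_one_four_mul_iff hs h]
  have := h.even_or_odd.resolve_left hAB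
  have := dvd_and_not_dvd_of_sixtyFour_dvd hD
  rcases hs with rfl | rfl <;> omega

theorem krausDiv_two_two_four_mul_iff (hs : s = 1 ∨ s = -1) (hD : A ^ 3 - B ^ 2 = 1728 * D)
    (hmin : ¬ KrausDiv 2 1 A B) :
    KrausDiv 2 2 (4 * A) (8 * (s * B)) ↔
      (64 ∣ A ∧ ¬ 128 ∣ A) ∧ (512 ∣ B ∧ ¬ 1024 ∣ B) ∧ 262144 ∣ D ∧ s * (B / 512) % 4 = 3 := by
  have hs2 : s ^ 2 = 1 := by rcases hs with rfl | rfl <;> rfl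
  constructor
  · rintro ⟨a, b, ha, hb, hab⟩
    norm_num at ha hb
    obtain rfl : A = 64 * a := by omega
    obtain rfl : B = 512 * (s * b) := by rcases hs with rfl | rfl <;> omega
    rw [kraus_two_iff] at hab
    rcases hab.even_or_odd with hodd | ⟨ha16, hb⟩
    · have := hab.2
      have := (dvd_cube_sub_sq_iff (m := 18) (D := D)
        (by linear_combination hD + 2 ^ 18 * b ^ 2 * hs2)).1 hab.1
      rcases hs with rfl | rfl <;> omega
    · exact absurd (krausDiv_two_one_of_dvd (by omega) (by rcases hs with rfl | rfl <;> omega)) hmin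
  · rintro ⟨⟨⟨a, rfl⟩, -⟩, ⟨⟨b, rfl⟩, -⟩, hD', h⟩
    rw [Int.mul_ediv_cancel_left _ (by norm_num)] at h
    refine ⟨a, s * b, by norm_num; ring, by norm_num; ring, kraus_two_iff.2 ⟨?_, by omega⟩⟩
    exact (dvd_cube_sub_sq_iff (m := 18)
      (by linear_combination hD - 2 ^ 18 * b ^ 2 * hs2)).2 hD'

theorem not_krausDiv_two_three_four_mul (hs : s = 1 ∨ s = -1) (hmin : ¬ KrausDiv 2 1 A B) :
    ¬ KrausDiv 2 3 (4 * A) (8 * (s * B)) := by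
  rintro ⟨a, b, ha, hb, -⟩
  norm_num at ha hb
  exact hmin (krausDiv_two_one_of_dvd (by omega) (by rcases hs with rfl | rfl <;> omega))

theorem pval_eq_zero_iff {p : ℕ} {n : ℤ} : pval p n = 0 ↔ ¬ (p : ℤ) ∣ n :=
  emultiplicity_eq_zero

theorem mul_modEq_four_iff {z w r : ℤ} (h : 4 ∣ w - s) :
    z * w ≡ r [ZMOD 4] ↔ s * z % 4 = r % 4 := by
  have hwz : z * w ≡ s * z [ZMOD 4] := by
    rw [mul_comm s]
    exact (Int.modEq_iff_dvd.2 h).symm.mul_left z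
  exact ⟨hwz.symm.trans, hwz.trans⟩

variable {E : WeierstrassCurve ℤ} {d w : ℤ}

open Classical in
theorem evenFactor_eq_of_three_mod_four (hmin : ¬ KrausDiv 2 1 E.c₄ E.c₆) (hd : d % 4 = 3) :
    evenFactor E d = if KrausTwo E.c₄ (-E.c₆) then
      if KrausDiv 2 1 E.c₄ (-E.c₆) then 2 else 1 else 1 / 2 := by
  have hd1 : ¬ d ≡ 1 [ZMOD 4] := by simp [Int.ModEq, hd]
  have hd3 : d ≡ 3 [ZMOD 4] := hd
  have hd4 : 4 ∣ d - -1 := by omega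
  have hD := E.c_relation.symm
  rw [evenFactor, if_neg hd1, if_pos hd3, ← ite_not (p := KrausTwo _ _)]
  refine if_congr ?_ rfl (if_congr ?_ rfl rfl)
  · rw [not_krausTwo_neg_iff (krausTwo_invariants E) hD]
    simp only [pval_eq_ofNat_iff, ofNat_le_pval_iff, pval_eq_zero_iff]
    norm_num only [Nat.cast_ofNat]
  · rw [krausDiv_two_one_neg_iff hD hmin]
    simp only [mul_modEq_four_iff hd4, pval_eq_ofNat_iff, ofNat_le_pval_iff]
    norm_num only [Nat.cast_ofNat]
    omega

open Classical in
theorem evenFactor_two_mul_eq (hs : s = 1 ∨ s = -1) (hw : 4 ∣ w - s)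
    (hmin : ¬ KrausDiv 2 1 E.c₄ E.c₆) :
    evenFactor E (2 * w) = if KrausTwo (4 * E.c₄) (8 * (s * E.c₆)) then
      if KrausDiv 2 2 (4 * E.c₄) (8 * (s * E.c₆)) then 4
      else if KrausDiv 2 1 (4 * E.c₄) (8 * (s * E.c₆)) then 2 else 1 else 1 / 2 := by
  have h1 : ¬ 2 * w ≡ 1 [ZMOD 4] := by simp only [Int.ModEq]; omega
  have h3 : ¬ 2 * w ≡ 3 [ZMOD 4] := by simp only [Int.ModEq]; omega
  have hD := E.c_relation.symm
  have hK := krausTwo_invariants E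
  rw [evenFactor, if_neg h1, if_neg h3, Int.mul_ediv_cancel_left _ (by norm_num),
    ← ite_not (p := KrausTwo _ _), ← ite_not (p := KrausDiv 2 1 _ _)]
  refine if_ctx_congr ?_ (fun _ => rfl) fun hodd => if_congr ?_ rfl (if_congr ?_ rfl rfl)
  · simp only [krausTwo_four_mul_iff hK, not_not, pval_eq_zero_iff]
    norm_num only [Nat.cast_ofNat]
  · simp only [krausDiv_two_two_four_mul_iff hs hD hmin, mul_modEq_four_iff hw,
      pval_eq_ofNat_iff, ofNat_le_pval_iff]
    norm_num only [Nat.cast_ofNat]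
  · rw [not_not, krausTwo_four_mul_iff hK] at hodd
    simp only [not_krausDiv_two_one_four_mul_iff hs hK hD hodd, mul_modEq_four_iff hw,
      pval_eq_ofNat_iff, ofNat_le_pval_iff]
    norm_num only [Nat.cast_ofNat]

theorem hasMinimalModelAt_two_mul_twist_iff (hw : 4 ∣ w - 1) (t : ℤ) (u : ℚ) :
    HasMinimalModelAt 2 (((t * w : ℤ) : ℚ) ^ 2 * A / u ^ 4) (((t * w : ℤ) : ℚ) ^ 3 * B / u ^ 6) ↔
      HasMinimalModelAt 2 ((t ^ 2 * A : ℤ) / u ^ 4) ((t ^ 3 * B : ℤ) / u ^ 6) := by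
  convert hasMinimalModelAt_twist_iff Nat.prime_two (show ¬ ((2 : ℕ) : ℤ) ∣ w by omega)
    (fun _ => hw) using 2 <;> push_cast <;> ring

theorem hasMinimalModelAt_div_half_iff :
    HasMinimalModelAt 2 (A / (1 / 2) ^ 4) (B / (1 / 2) ^ 6) ↔ ¬ KrausTwo A B := by
  rw [← hasMinimalModelAt_two_pow_mul_iff]
  convert Iff.rfl using 2 <;> ring

theorem hasMinimalModelAt_evenFactor_of_three_mod_four (hmin : ¬ KrausDiv 2 1 E.c₄ E.c₆)
    (hd : d % 4 = 3) : HasMinimalModelAt 2 (d ^ 2 * E.c₄ / evenFactor E d ^ 4)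
      (d ^ 3 * E.c₆ / evenFactor E d ^ 6) := by
  have htwist := hasMinimalModelAt_two_mul_twist_iff (A := E.c₄) (B := E.c₆)
    (show 4 ∣ -d - 1 by omega) (-1) (evenFactor E d)
  rw [show (-1) * -d = d by ring] at htwist
  rw [htwist, evenFactor_eq_of_three_mod_four hmin hd,
    show (-1) ^ 2 * E.c₄ = E.c₄ by ring, show (-1) ^ 3 * E.c₆ = -E.c₆ by ring]
  split_ifs with h₀ h₁
  · simpa using (hasMinimalModelAt_div_pow_iff Nat.prime_two (j := 1)).2
      ⟨h₁, not_krausDiv_two_two_neg hmin⟩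
  · simpa using (hasMinimalModelAt_div_pow_iff Nat.prime_two (j := 0)).2
      ⟨krausDiv_zero_iff.2 (kraus_two_iff.2 h₀), h₁⟩
  · exact hasMinimalModelAt_div_half_iff.2 h₀

theorem hasMinimalModelAt_evenFactor_two_mul (hs : s = 1 ∨ s = -1) (hw : 4 ∣ w - s)
    (hmin : ¬ KrausDiv 2 1 E.c₄ E.c₆) :
    HasMinimalModelAt 2 (((2 * w : ℤ) : ℚ) ^ 2 * E.c₄ / evenFactor E (2 * w) ^ 4)
      (((2 * w : ℤ) : ℚ) ^ 3 * E.c₆ / evenFactor E (2 * w) ^ 6) := by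
  have htwist := hasMinimalModelAt_two_mul_twist_iff (A := E.c₄) (B := E.c₆)
    (show 4 ∣ s * w - 1 by rcases hs with rfl | rfl <;> omega) (2 * s) (evenFactor E (2 * w))
  have hw' : 2 * s * (s * w) = 2 * w := by rcases hs with rfl | rfl <;> ring
  have hA : (2 * s) ^ 2 * E.c₄ = 4 * E.c₄ := by rcases hs with rfl | rfl <;> ring
  have hB : (2 * s) ^ 3 * E.c₆ = 8 * (s * E.c₆) := by rcases hs with rfl | rfl <;> ring
  rw [hw', hA, hB] at htwist
  rw [htwist, evenFactor_two_mul_eq hs hw hmin]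
  split_ifs with h₀ h₂ h₁
  · simpa [show (4 : ℚ) = 2 ^ 2 by norm_num] using
      (hasMinimalModelAt_div_pow_iff Nat.prime_two (j := 2)).2
        ⟨h₂, not_krausDiv_two_three_four_mul hs hmin⟩
  · simpa using (hasMinimalModelAt_div_pow_iff Nat.prime_two (j := 1)).2 ⟨h₁, h₂⟩
  · simpa using (hasMinimalModelAt_div_pow_iff Nat.prime_two (j := 0)).2
      ⟨krausDiv_zero_iff.2 (kraus_two_iff.2 h₀), h₁⟩
  · exact hasMinimalModelAt_div_half_iff.2 h₀

theorem hasMinimalModelAt_evenFactor (hd : Squarefree d)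
    (hE : HasMinimalModelAt 2 E.c₄ E.c₆) :
    HasMinimalModelAt 2 (d ^ 2 * E.c₄ / evenFactor E d ^ 4)
      (d ^ 3 * E.c₆ / evenFactor E d ^ 6) := by
  have hmin : ¬ KrausDiv 2 1 E.c₄ E.c₆ := by simpa using
    ((hasMinimalModelAt_div_pow_iff Nat.prime_two (j := 0)).1 (by simpa using hE)).2
  have hd4 : ¬ 4 ∣ d := fun ⟨v, hv⟩ =>
    Int.prime_two.not_isUnit (hd 2 ⟨v, hv.trans (by ring)⟩)
  obtain h1 | h3 | ⟨w, rfl⟩ : d % 4 = 1 ∨ d % 4 = 3 ∨ 2 ∣ d := by omega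
  · have hfactor : evenFactor E d = 1 := if_pos h1
    simpa [hfactor] using (hasMinimalModelAt_twist_iff Nat.prime_two (by omega) (by omega)).2 hE
  · exact hasMinimalModelAt_evenFactor_of_three_mod_four hmin h3
  · obtain hw | hw : 4 ∣ w - 1 ∨ 4 ∣ w - -1 := by omega
    · exact hasMinimalModelAt_evenFactor_two_mul (Or.inl rfl) hw hmin
    · exact hasMinimalModelAt_evenFactor_two_mul (Or.inr rfl) hw hmin

end TwistAtTwo

section GlobalFactor

variable {p q : ℕ} {E : WeierstrassCurve ℤ} {d : ℤ}

theorem hasMinimalModelAt_localFactor (hp : p.Prime) (hd : Squarefree d)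
    (hE : HasMinimalModelAt p E.c₄ E.c₆) :
    HasMinimalModelAt p (d ^ 2 * E.c₄ / localFactor E d p ^ 4)
      (d ^ 3 * E.c₆ / localFactor E d p ^ 6) := by
  unfold localFactor
  split_ifs with hp2
  · subst hp2
    exact hasMinimalModelAt_evenFactor hd hE
  · exact hasMinimalModelAt_oddFactor hp hp2 hd hE

theorem localFactor_eq_zpow (E : WeierstrassCurve ℤ) (d : ℤ) (p : ℕ) :
    ∃ k : ℤ, localFactor E d p = p ^ k := by
  unfold localFactor evenFactor oddFactor
  split_ifs with hp2
  all_goals try rw [hp2]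
  all_goals
    first
      | use 0; norm_num; done
      | use 1; norm_num; done
      | use 2; norm_num; done
      | use -1; norm_num

theorem padicValRat_localFactor_of_ne (hp : p.Prime) (hq : q.Prime) (hpq : p ≠ q) :
    padicValRat p (localFactor E d q) = 0 := by
  have := Fact.mk hp
  have := Fact.mk hq
  obtain ⟨k, hk⟩ := localFactor_eq_zpow E d q
  rw [hk, padicValRat.zpow, padicValRat.of_nat, padicValNat_primes hpq, Nat.cast_zero, mul_zero]

theorem localFactor_of_not_dvd (h : ¬ (p : ℤ) ∣ 2 * d) : localFactor E d p = 1 := by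
  have hp2 : p ≠ 2 := by
    rintro rfl
    exact h (dvd_mul_right _ _)
  rw [localFactor, if_neg hp2, oddFactor, if_neg (mt (Dvd.dvd.mul_left · 2) h)]

theorem padicValRat_prod_eq_zero [Fact p.Prime] {ι : Type*} {S : Finset ι} {f : ι → ℚ}
    (h : ∀ i ∈ S, f i ≠ 0 ∧ padicValRat p (f i) = 0) : padicValRat p (∏ i ∈ S, f i) = 0 :=
  (Finset.prod_induction f (fun x => x ≠ 0 ∧ padicValRat p x = 0)
    (fun _ _ hx hy => ⟨mul_ne_zero hx.1 hy.1, by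
      rw [padicValRat.mul hx.1 hy.1, hx.2, hy.2, add_zero]⟩)
    ⟨one_ne_zero, padicValRat.one⟩ h).2

theorem padicValRat_twistFactor_div (hp : p.Prime) (hd : d ≠ 0) :
    padicValRat p (localFactor E d p / twistFactor E d) = 0 := by
  have := Fact.mk hp
  have hprod : (twistFactor E d : ℚ) =
      localFactor E d p * ∏ q ∈ (2 * d).natAbs.primeFactors.erase p, localFactor E d q := by
    rw [twistFactor, Units.val_mk0]
    by_cases hmem : p ∈ (2 * d).natAbs.primeFactors
    · exact (Finset.mul_prod_erase _ _ hmem).symm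
    · rw [Finset.erase_eq_of_notMem hmem, localFactor_of_not_dvd, one_mul]
      rw [Int.natCast_dvd]
      exact fun h => hmem (Nat.mem_primeFactors.2 ⟨hp, h, by simpa using hd⟩)
  rw [hprod, div_mul_cancel_left₀ (localFactor_ne_zero E d hp), padicValRat.inv, neg_eq_zero]
  refine padicValRat_prod_eq_zero fun q hq => ?_
  have hqp := Nat.prime_of_mem_primeFactors (Finset.mem_of_mem_erase hq)
  exact ⟨localFactor_ne_zero E d hqp,
    padicValRat_localFactor_of_ne hp hqp (Finset.ne_of_mem_erase hq).symm⟩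

theorem hasMinimalModelAt_twistFactor (hp : p.Prime) (hd : Squarefree d)
    (hE : HasMinimalModelAt p E.c₄ E.c₆) :
    HasMinimalModelAt p (d ^ 2 * E.c₄ / twistFactor E d ^ 4)
      (d ^ 3 * E.c₆ / twistFactor E d ^ 6) := by
  have hp0 := localFactor_ne_zero E d hp
  convert (hasMinimalModelAt_localFactor hp hd hE).mul hp
    (div_ne_zero hp0 (twistFactor E d).ne_zero) (padicValRat_twistFactor_div hp hd.ne_zero)
    using 1 <;> field_simp

theorem quadraticTwist_c₄ (W : WeierstrassCurve ℚ) (d : ℤ) :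
    (W.quadraticTwist d).c₄ = d ^ 2 * W.c₄ := by
  simp only [quadraticTwist, c₄, b₂, b₄]
  ring

theorem quadraticTwist_c₆ (W : WeierstrassCurve ℚ) (d : ℤ) :
    (W.quadraticTwist d).c₆ = d ^ 3 * W.c₆ := by
  simp only [quadraticTwist, c₆, b₂, b₄, b₆]
  ring

theorem quadraticTwist_Δ (W : WeierstrassCurve ℚ) (d : ℤ) :
    (W.quadraticTwist d).Δ = d ^ 6 * W.Δ := by
  simp only [quadraticTwist, Δ, b₂, b₄, b₆, b₈]
  ring

theorem exists_twistModel_isGlobalMinimal (hE : (E.baseChange ℚ).IsGlobalMinimal)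
    (hd : Squarefree d) : ∃ r s t : ℚ, (E.twistModel d r s t).IsGlobalMinimal := by
  refine exists_isGlobalMinimal ?_ (twistFactor E d) fun p hp => ?_
  · rw [quadraticTwist_Δ]
    exact mul_ne_zero (pow_ne_zero _ (Int.cast_ne_zero.2 hd.ne_zero)) hE.isElliptic.isUnit.ne_zero
  · have hEp := hasMinimalModelAt_of_isGlobalMinimal hp hE
    rw [baseChange_rat_c₄, baseChange_rat_c₆] at hEp
    rw [quadraticTwist_c₄, quadraticTwist_c₆, baseChange_rat_c₄, baseChange_rat_c₆]
    exact hasMinimalModelAt_twistFactor hp hd hEp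

end GlobalFactor

end QuadraticTwist

theorem mainTheorem5 (E : WeierstrassCurve ℤ) (hE : (E.baseChange ℚ).IsGlobalMinimal)
    (d : ℤ) (hd : Squarefree d)
    {K : Type*} [Field K] [Algebra ℚ K] (δ : Kˣ) (hδ : (δ : K) ^ 2 = d) :
    E.twistPullback d δ hδ
        (((E.baseChange ℚ).quadraticTwist d).baseChange K).invariantDifferential =
      (1 / (δ : K)) • ((E.baseChange ℚ).baseChange K).invariantDifferential ∧
    (∃ r s t : ℚ, (E.twistModel d r s t).IsGlobalMinimal) ∧
    ∀ r s t : ℚ, (E.twistModel d r s t).IsGlobalMinimal →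
      E.twistPullback d δ hδ
          (E.modelPullback d r s t ((E.twistModel d r s t).baseChange K).invariantDifferential) =
        (algebraMap ℚ K (E.twistFactor d) / (δ : K)) •
          ((E.baseChange ℚ).baseChange K).invariantDifferential := by
  have htwist := QuadraticTwist.twistPullback_invariantDifferential (E := E) δ hδ
  refine ⟨htwist, QuadraticTwist.exists_twistModel_isGlobalMinimal hE hd, fun r s t _ => ?_⟩
  rw [QuadraticTwist.modelPullback_invariantDifferential, map_smul, htwist, smul_smul, mul_one_div]
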